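/- Let $\mathcal G$ be the dumbbell graph: two vertices joined by an edge $e_3$, with a loop $e_1$ at the first vertex and a loop $e_2$ at the second. Each edge $e$ gives two directed edges $e,\bar e$; let $A(e,e')=1$ if the directed edge $e'$ starts where $e$ ends and $e'\neq\bar e$, and $A(e,e')=0$ otherwise. Let $\Sigma_A^+$ be the one-sided subshift of finite type of $A$, with shift $\sigma$. For $l:\{e_1,e_2,e_3\}\to\mathbb R_{>0}$ the entropy is $$h(l)=\lim_{T\to\infty}\frac1T\log\#\{\gamma:\ l(\gamma)<T\},$$ where $\gamma$ runs over the closed cycles $(e_0,e_1,\dots,e_n=e_0)$ of directed edges without backtracking and $l(\gamma)=\sum_{i<n}l(e_i)$; let $\mathcal M^1=\{l>0:\ h(l)=1\}$. A function $\phi$ of edges is regarded as the function $\phi(\underline e)=\phi(e_0)$ on $\Sigma_A^+$. For continuous $f$ on $\Sigma_A^+$ let $\mathcal L_f w(\underline x)=\sum_{\sigma\underline y=\underline x}e^{f(\underline y)}w(\underline y)$, let $\beta_f$ be the spectral radius of $\mathcal L_f$ on $C(\Sigma_A^+)$, and let $P(f)=\log\beta_f$. If $P(f)=0$, the equilibrium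 state of $f$ is $m_f=v_f\mu_f/\int v_f\,d\mu_f$, where $v_f>0$ is continuous with $\mathcal L_fv_f=\beta_fv_f$ and $\mu_f$ is a probability measure with $\mathcal L_f^*\mu_f=\beta_f\mu_f$. For a $\sigma$-invariant probability measure $m$ let $$\mathrm{Var}(w,m)=\lim_{n\to\infty}\frac1n\int\Big(\sum_{i=0}^{n-1}w\circ\sigma^i-n\int w\,dm\Big)^2dm .$$ The pressure metric on $T_l\mathcal M^1=\{\phi:\ \phi(\underline e)=\phi(e_0),\ \int\phi\,dm_{-l}=0\}$ is $\|\phi\|_P^2=\mathrm{Var}(\phi,m_{-l})$. **Proposition.** With $x=l(e_1)$, $y=l(e_2)$, the space $\mathcal M^1$ is the surface $$l(x,y)=(x,y,S(x,y)),\qquad S(x,y)=\log 2-\tfrac12\log\big((e^x-1)(e^y-1)\big),\qquad x,y>0,\ (e^x-1)(e^y-1)<4 .$$ At each of its points $-l$ has a unique equilibrium state $m_{-l}$, the vectors $\partial l/\partial x,\partial l/\partial y$ lie in $T_l\mathcal M^1$, and, with $\mathbf p_3=m_{-l}\{\underline e:\ e_0=e_3\}$, the first fundamental form of $(\mathcal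 M^1,\|\cdot\|_P)$ is $$E_P=\mathrm{Var}\Big(\frac{\partial l}{\partial x},m_{-l}\Big)=2\,\frac{\partial^2S}{\partial x^2}\,\mathbf p_3=\frac{e^x(e^y-1)}{(e^x-1)(4e^{x+y}-3e^x-3e^y+2)},$$ $$F_P=\frac12\Big(\mathrm{Var}\Big(\frac{\partial l}{\partial x}+\frac{\partial l}{\partial y},m_{-l}\Big)-\mathrm{Var}\Big(\frac{\partial l}{\partial x},m_{-l}\Big)-\mathrm{Var}\Big(\frac{\partial l}{\partial y},m_{-l}\Big)\Big)=0,$$ $$G_P=\mathrm{Var}\Big(\frac{\partial l}{\partial y},m_{-l}\Big)=2\,\frac{\partial^2S}{\partial y^2}\,\mathbf p_3=\frac{(e^x-1)e^y}{(e^y-1)(4e^{x+y}-3e^x-3e^y+2)},$$ that is, $\big\|a\,\frac{\partial l}{\partial x}+b\,\frac{\partial l}{\partial y}\big\|_P^2=E_Pa^2+2F_Pab+G_Pb^2$ for all $a,b\in\mathbb R$; in particular all these limits exist. -/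

import Mathlib

open Filter Topology MeasureTheory

noncomputable section

section SymbolicDynamics

variable {ι : Type*}

/-- The one-sided subshift of finite type `Σ_A⁺` of a `0`-`1` matrix `A`. It carries the subspace
topology of the product topology, and the subspace `σ`-algebra of the product `σ`-algebra. -/
abbrev Subshift (A : Matrix ι ι ℕ) : Type _ :=
  {x : ℕ → ι // ∀ n, A (x n) (x (n + 1)) = 1}

/-- The shift map `(σ x)ₙ = xₙ₊₁`. -/
def Subshift.shift {A : Matrix ι ι ℕ} (x : Subshift A) : Subshift A :=
  ⟨fun n => x.1 (n + 1), fun n => x.2 (n + 1)⟩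

/-- The sequence `i x₀ x₁ x₂ …`. The preimages of `x` under the shift are exactly the sequences
`i x₀ x₁ …` with `A i x₀ = 1`. -/
def Subshift.cons {A : Matrix ι ι ℕ} (i : ι) (x : Subshift A) (h : A i (x.1 0) = 1) :
    Subshift A :=
  ⟨fun n => Nat.casesOn n i x.1, fun n => by cases n with
    | zero => exact h
    | succ k => exact x.2 k⟩

/-- The preimages of a point under the shift, as used in the transfer operator. -/
theorem Subshift.shift_eq_iff {A : Matrix ι ι ℕ} (x y : Subshift A) :
    y.shift = x ↔ ∃ (i : ι) (h : A i (x.1 0) = 1), y = Subshift.cons i x h := by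
  constructor
  · rintro rfl
    refine ⟨y.1 0, y.2 0, Subtype.ext (funext fun n => ?_)⟩
    cases n <;> rfl
  · rintro ⟨i, h, rfl⟩
    rfl

variable [TopologicalSpace ι] [DiscreteTopology ι]

instance Subshift.compactSpace [Finite ι] (A : Matrix ι ι ℕ) : CompactSpace (Subshift A) := by
  have hc : IsClosed {x : ℕ → ι | ∀ n, A (x n) (x (n + 1)) = 1} := by
    rw [Set.ofPred_forall]
    refine isClosed_iInter fun n => ?_
    have hcont : Continuous fun x : ℕ → ι => (x n, x (n + 1)) := by fun_prop
    exact (isClosed_discrete {p : ι × ι | A p.1 p.2 = 1}).preimage hcont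
  exact isCompact_iff_compactSpace.mp hc.isCompact

/-- One summand of the transfer operator is continuous. -/
theorem Subshift.continuous_summand (A : Matrix ι ι ℕ) (i : ι) (g : C(Subshift A, ℝ)) :
    Continuous fun x : Subshift A =>
      if h : A i (x.1 0) = 1 then g (Subshift.cons i x h) else 0 := by
  classical
  rw [continuous_iff_continuousAt]
  intro x
  have hx0 : Continuous fun y : Subshift A => y.1 0 :=
    (continuous_apply (A := fun _ : ℕ => ι) 0).comp continuous_subtype_val
  have hev : ∀ᶠ y : Subshift A in 𝓝 x, y.1 0 = x.1 0 :=
    hx0.continuousAt.eventually (p := fun j => j = x.1 0) (by simp [nhds_discrete])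
  by_cases h : A i (x.1 0) = 1
  · let U : Set (Subshift A) := {y | y.1 0 = x.1 0}
    have hU : IsOpen U := (isOpen_discrete {x.1 0}).preimage hx0
    have hcont : ContinuousOn (fun x : Subshift A =>
        if h : A i (x.1 0) = 1 then g (Subshift.cons i x h) else 0) U := by
      rw [continuousOn_iff_continuous_domRestrict]
      have hA : ∀ y : U, A i (y.1.1 0) = 1 := fun y => by
        have : y.1.1 0 = x.1 0 := y.2
        rw [this]; exact h
      have hc : Continuous fun y : U => Subshift.cons i y.1 (hA y) := by
        refine Continuous.subtype_mk (continuous_pi fun n => ?_) _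
        cases n with
        | zero => exact continuous_const
        | succ k => exact (continuous_apply k).comp (continuous_subtype_val.comp
            continuous_subtype_val)
      convert g.continuous.comp hc using 1
      funext y
      simp [hA y]
    exact hcont.continuousAt (hU.mem_nhds rfl)
  · refine ContinuousAt.congr (f := fun _ => (0 : ℝ)) continuousAt_const ?_
    filter_upwards [hev] with y hy
    rw [dif_neg]
    rw [hy]; exact h

variable [Fintype ι] {A : Matrix ι ι ℕ}

/-- The transfer operator of `f` applied to `w`:
`(𝓛_f w)(x) = ∑_{σ y = x} exp (f y) * w y`, a continuous function of `x`. -/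
def transferFun (f w : C(Subshift A, ℝ)) : C(Subshift A, ℝ) where
  toFun x := ∑ i : ι, if h : A i (x.1 0) = 1 then
    Real.exp (f (Subshift.cons i x h)) * w (Subshift.cons i x h) else 0
  continuous_toFun := continuous_finsetSum _ fun i _ =>
    Subshift.continuous_summand A i ⟨fun y => Real.exp (f y) * w y, by fun_prop⟩

theorem abs_transferFun_le (f w : C(Subshift A, ℝ)) :
    ‖transferFun f w‖ ≤ (Fintype.card ι * Real.exp ‖f‖) * ‖w‖ := by
  rw [ContinuousMap.norm_le _ (by positivity)]
  intro x
  have hsum : ∀ i ∈ (Finset.univ : Finset ι),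
      ‖(if h : A i (x.1 0) = 1 then
        Real.exp (f (Subshift.cons i x h)) * w (Subshift.cons i x h) else 0 : ℝ)‖
        ≤ Real.exp ‖f‖ * ‖w‖ := by
    intro i _
    split_ifs with h
    · rw [norm_mul, Real.norm_eq_abs, Real.abs_exp]
      gcongr
      · exact (le_abs_self _).trans (f.norm_coe_le_norm _)
      · exact w.norm_coe_le_norm _
    · rw [norm_zero]; positivity
  calc ‖transferFun f w x‖ ≤ ∑ _i : ι, Real.exp ‖f‖ * ‖w‖ := norm_sum_le_of_le _ hsum
    _ = _ := by simp [mul_assoc]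

/-- The transfer (Ruelle) operator `𝓛_f` as a bounded operator on `C(Σ_A⁺)`. -/
def transferOp (f : C(Subshift A, ℝ)) : C(Subshift A, ℝ) →L[ℝ] C(Subshift A, ℝ) :=
  LinearMap.mkContinuous
    { toFun := transferFun f
      map_add' := fun u w => by
        ext x
        simp only [transferFun, ContinuousMap.coe_mk, ContinuousMap.add_apply,
          ← Finset.sum_add_distrib]
        refine Finset.sum_congr rfl fun i _ => ?_
        split_ifs <;> ring
      map_smul' := fun c w => by
        ext x
        simp only [transferFun, ContinuousMap.coe_mk, ContinuousMap.smul_apply, smul_eq_mul,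
          RingHom.id_apply, Finset.mul_sum]
        refine Finset.sum_congr rfl fun i _ => ?_
        split_ifs <;> ring }
    (Fintype.card ι * Real.exp ‖f‖) (abs_transferFun_le f)

/-- The spectral radius `β_f` of the transfer operator `𝓛_f` on `C(Σ_A⁺)`. -/
def perronValue (f : C(Subshift A, ℝ)) : ℝ := (spectralRadius ℝ (transferOp f)).toReal

/-- The pressure `P(f) = log β_f`. -/
def pressure (f : C(Subshift A, ℝ)) : ℝ := Real.log (perronValue f)

/-- `m` is the equilibrium state `m_f = v_f μ_f / ∫ v_f dμ_f` of a function `f` of pressure zero,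
where `v_f` is a strictly positive eigenfunction of `𝓛_f` and `μ_f` a probability measure that is
an eigenmeasure of the dual of `𝓛_f`, both for the eigenvalue `β_f`. -/
def IsEquilibriumState [MeasurableSpace ι] [DiscreteMeasurableSpace ι] (f : C(Subshift A, ℝ)) (m : Measure (Subshift A)) :
    Prop :=
  pressure f = 0 ∧
  ∃ (v : C(Subshift A, ℝ)) (μ : Measure (Subshift A)),
    (∀ x, 0 < v x) ∧ transferOp f v = perronValue f • v ∧
    IsProbabilityMeasure μ ∧
    (∀ φ : C(Subshift A, ℝ), ∫ x, transferOp f φ x ∂μ = perronValue f * ∫ x, φ x ∂μ) ∧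
    m = μ.withDensity fun x => ENNReal.ofReal (v x / ∫ y, v y ∂μ)

/-- `Var(w, μ) = s`: the limit `lim (1/n) ∫ (wⁿ - n ∫ w dμ)² dμ`, with
`wⁿ = ∑_{i<n} w ∘ σⁱ`, exists and equals `s`. -/
def HasVariance [MeasurableSpace ι] [DiscreteMeasurableSpace ι] (w : C(Subshift A, ℝ)) (μ : Measure (Subshift A)) (s : ℝ) :
    Prop :=
  Tendsto (fun n : ℕ => (1 / (n : ℝ)) *
    ∫ x, (birkhoffSum Subshift.shift w n x - n * ∫ y, w y ∂μ) ^ 2 ∂μ) atTop (𝓝 s)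

end SymbolicDynamics

section MetricGraphs

/-- An undirected graph with vertices `V` and edges `E`; loops and multiple edges are allowed.
The endpoints of each edge are listed in an arbitrary reference order. -/
structure UGraph (V E : Type*) where
  ini : E → V
  ter : E → V

namespace UGraph

variable {V E : Type*} (G : UGraph V E)

/-- Initial vertex of a directed edge. The directed edges are the pairs `(e, b)`: the edge `e`
travelled from `ini e` to `ter e` if `b = true`, and the other way if `b = false`. -/
def start (d : E × Bool) : V := if d.2 then G.ini d.1 else G.ter d.1

/-- Terminal vertex of a directed edge. -/
def finish (d : E × Bool) : V := if d.2 then G.ter d.1 else G.ini d.1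

/-- The directed edge with the opposite direction. -/
def rev (d : E × Bool) : E × Bool := (d.1, !d.2)

/-- The adjacency matrix on directed edges: `A(e, e') = 1` if `e'` follows `e` and `e' ≠ ē`. -/
def adj [DecidableEq V] [DecidableEq E] : Matrix (E × Bool) (E × Bool) ℕ := fun d d' =>
  if G.finish d = G.start d' ∧ d' ≠ rev d then 1 else 0

variable [DecidableEq V] [DecidableEq E]

/-- The closed cycles `(e₀, …, eₙ, e₀)` of directed edges without backtracking and of total length
`< T` (the addition in `Fin (n + 1)` is cyclic, so the last edge is followed by the first). -/
def closedCycles (l : E → ℝ) (T : ℝ) : Set (Σ n : ℕ, Fin (n + 1) → E × Bool) :=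
  {γ | (∀ i, G.adj (γ.2 i) (γ.2 (i + 1)) = 1) ∧ ∑ i, l (γ.2 i).1 < T}

/-- The entropy `lim_{T → ∞} (1/T) log #{γ ; l(γ) < T}` of `(G, l)` exists and equals `h`. -/
def HasEntropy (l : E → ℝ) (h : ℝ) : Prop :=
  Tendsto (fun T : ℝ => (1 / T) * Real.log ((G.closedCycles l T).ncard : ℝ)) atTop (𝓝 h)

/-- The moduli space `𝓜¹_G` of positive edge weightings of entropy `1`. -/
def moduliSpace : Set (E → ℝ) := {l | (∀ e, 0 < l e) ∧ G.HasEntropy l 1}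

variable [TopologicalSpace E] [DiscreteTopology E]

/-- A function of edges, as the function `e₀e₁e₂… ↦ φ(e₀)` on the space of paths. -/
def edgeFun (φ : E → ℝ) : C(Subshift G.adj, ℝ) where
  toFun x := φ (x.1 0).1
  continuous_toFun := (continuous_of_discreteTopology (f := fun d : E × Bool => φ d.1)).comp
    ((continuous_apply (A := fun _ : ℕ => E × Bool) 0).comp continuous_subtype_val)

/-- The tangent space of `𝓜¹_G` at a weighting `l`, where `m` is the equilibrium state of `-l`:
the functions of the zeroth directed edge with zero integral. -/
def tangentSpace [MeasurableSpace E] [DiscreteMeasurableSpace E] (m : Measure (Subshift G.adj)) :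
    Set C(Subshift G.adj, ℝ) :=
  {φ | (∃ ψ : E × Bool → ℝ, ∀ x, φ x = ψ (x.1 0)) ∧ ∫ x, φ x ∂m = 0}

end UGraph

end MetricGraphs

section Dumbbell

/-- The dumbbell: two vertices, a loop `0` at the first one, a loop `1` at the second one, and
an edge `2` that joins the two vertices. -/
def dumbbell : UGraph (Fin 2) (Fin 3) where
  ini := ![0, 1, 0]
  ter := ![0, 1, 1]

/-- The length of the joining edge on the surface of entropy `1`, as a function of the lengths
`x`, `y` of the two loops. -/
def dumbbellS (x y : ℝ) : ℝ :=
  Real.log 2 - 1 / 2 * Real.log ((Real.exp x - 1) * (Real.exp y - 1))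

/-- The parametrization `l(x, y) = (x, y, S(x, y))`. -/
def dumbbellLength (x y : ℝ) : Fin 3 → ℝ := ![x, y, dumbbellS x y]

/-- The domain of the parametrization: `x`, `y` and `S(x, y)` are positive. -/
def dumbbellDomain : Set (ℝ × ℝ) :=
  {q | 0 < q.1 ∧ 0 < q.2 ∧ (Real.exp q.1 - 1) * (Real.exp q.2 - 1) < 4}

/-- The coordinate vector field `∂l/∂x`. -/
def dumbbellDx (x y : ℝ) : Fin 3 → ℝ := deriv (fun s => dumbbellLength s y) x

/-- The coordinate vector field `∂l/∂y`. -/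
def dumbbellDy (x y : ℝ) : Fin 3 → ℝ := deriv (fun s => dumbbellLength x s) y

end Dumbbell

end

/-!
If `W` is the weighted adjacency matrix `A(e, e') exp (-l e)` and `h = 1`, the transfer operator of
`-l` restricts to `W` on functions of the zeroth edge. A positive eigenvector of `W` with eigenvalue
`1` gives the spectral radius, the growth `exp T` of the number of paths of length `< T`, and hence
the entropy; along a ray of edge lengths the entropy scales, so the surface is met exactly once.
Irreducibility makes the positive eigenfunction unique, and the eigenmeasure is determined by its
values on cylinders, which gives the equilibrium state and its masses on edges.

For the variance, suppose `φ = ζ - ζ'` where the transfer operator normalized by the eigenvector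
maps `ζ` to `ζ'`. Composition with the shift is an isometry of `L²` whose adjoint is that operator,
so `φ` is a coboundary plus the reverse martingale difference `ζ - ζ' ∘ σ`, and
`Var(φ) = ∫ ζ² - ∫ ζ'²`. Reversing the edges turns left eigenvectors of `W` into right ones, so both
`ζ` and `ζ'` come from a single solution `η` of the Poisson equation `W (η r) = (η - φ) r`.
-/

section PositiveOperators

theorem mem_spectrum_of_apply_eq_smul {𝕜 E : Type*} [NontriviallyNormedField 𝕜]
    [NormedAddCommGroup E] [NormedSpace 𝕜 E] {T : E →L[𝕜] E} {u : E} {c : 𝕜} (hu : u ≠ 0)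
    (hTu : T u = c • u) : c ∈ spectrum 𝕜 T := by
  rw [spectrum.mem_iff]
  rintro ⟨R, hR⟩
  have hRu : (R : E →L[𝕜] E) u = 0 := by simp [hR, hTu, Algebra.algebraMap_eq_smul_one]
  have hinv : ((↑R⁻¹ : E →L[𝕜] E) * R) u = u := by rw [Units.inv_mul, one_apply_eq_self]
  rw [mul_apply_eq_comp, hRu, map_zero] at hinv
  exact hu hinv.symm

theorem norm_le_one_of_mem_spectrum_of_norm_pow_le {𝕜 B : Type*} [NormedField 𝕜] [NormedRing B]
    [NormedAlgebra 𝕜 B] [CompleteSpace B] {a : B} {K : ℝ} (ha : ∀ n, ‖a ^ n‖ ≤ K) {k : 𝕜}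
    (hk : k ∈ spectrum 𝕜 a) : ‖k‖ ≤ 1 := by
  by_contra! hlt
  obtain ⟨n, hn⟩ := pow_unbounded_of_one_lt (K * ‖(1 : B)‖) hlt
  refine hn.not_ge ?_
  calc ‖k‖ ^ n = ‖k ^ n‖ := (norm_pow k n).symm
    _ ≤ ‖a ^ n‖ * ‖(1 : B)‖ := spectrum.norm_le_norm_mul_of_mem (spectrum.pow_mem_pow a n hk)
    _ ≤ K * ‖(1 : B)‖ := by gcongr; exact ha n

theorem spectralRadius_eq_one_of_norm_pow_le {𝕜 E : Type*} [NontriviallyNormedField 𝕜]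
    [NormedAddCommGroup E] [NormedSpace 𝕜 E] [CompleteSpace E] {T : E →L[𝕜] E} {K : ℝ}
    (hT : ∀ n, ‖T ^ n‖ ≤ K) {u : E} (hu : u ≠ 0) (hTu : T u = u) : spectralRadius 𝕜 T = 1 := by
  refine le_antisymm (iSup₂_le fun k hk => ?_) ?_
  · exact_mod_cast norm_le_one_of_mem_spectrum_of_norm_pow_le hT hk
  · have hmem : (1 : 𝕜) ∈ spectrum 𝕜 T := mem_spectrum_of_apply_eq_smul hu (by rwa [one_smul])
    simpa [spectralRadius] using
      le_iSup₂ (f := fun (k : 𝕜) (_ : k ∈ spectrum 𝕜 T) => (‖k‖₊ : ENNReal)) 1 hmem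

variable {X : Type*} [TopologicalSpace X] [CompactSpace X] {L : C(X, ℝ) →L[ℝ] C(X, ℝ)}
  {u : C(X, ℝ)}

theorem norm_le_of_monotone_of_apply_eq (hL : Monotone L) {δ : ℝ} (hδ : 0 < δ)
    (hu : ∀ x, δ ≤ u x) (hLu : L u = u) : ‖L‖ ≤ ‖u‖ / δ := by
  refine L.opNorm_le_bound (by positivity) fun w => ?_
  rw [ContinuousMap.norm_le _ (by positivity)]
  intro x
  have habs (y : X) : |w y| ≤ (‖w‖ / δ) * u y :=
    calc |w y| ≤ ‖w‖ := w.norm_coe_le_norm y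
      _ = (‖w‖ / δ) * δ := (div_mul_cancel₀ _ hδ.ne').symm
      _ ≤ (‖w‖ / δ) * u y := by gcongr; exact hu y
  have hupper : L w ≤ (‖w‖ / δ) • u := by
    rw [← hLu, ← map_smul]
    exact hL fun y => (abs_le.1 (habs y)).2
  have hlower : -((‖w‖ / δ) • u) ≤ L w := by
    rw [← hLu, ← map_smul, ← map_neg]
    exact hL fun y => (abs_le.1 (habs y)).1
  calc |L w x| ≤ (‖w‖ / δ) * u x := abs_le.2 ⟨hlower x, hupper x⟩
    _ ≤ (‖w‖ / δ) * ‖u‖ := by gcongr; exact (le_abs_self _).trans (u.norm_coe_le_norm x)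
    _ = ‖u‖ / δ * ‖w‖ := by ring

theorem exists_isProbabilityMeasure_integral_eq_mul [T2Space X] [MeasurableSpace X] [BorelSpace X]
    {Λ : C(X, ℝ) →L[ℝ] ℝ} (hΛ : ∀ φ, (∀ x, 0 < φ x) → 0 < Λ φ) :
    ∃ μ : Measure X, IsProbabilityMeasure μ ∧ ∃ c : ℝ, ∀ φ : C(X, ℝ), ∫ x, φ x ∂μ = c * Λ φ := by
  have hnonneg (φ : C(X, ℝ)) (hφ : 0 ≤ φ) : 0 ≤ Λ φ := by
    have hlim : Tendsto (fun ε : ℝ => Λ (φ + ε • 1)) (𝓝[>] 0) (𝓝 (Λ φ)) := by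
      refine (Continuous.tendsto' ?_ 0 (Λ φ) (by simp)).mono_left nhdsWithin_le_nhds
      fun_prop
    refine ge_of_tendsto hlim (eventually_nhdsWithin_of_forall fun ε hε => (hΛ _ fun x => ?_).le)
    simpa using add_pos_of_nonneg_of_pos (hφ x) hε
  let Λc : CompactlySupportedContinuousMap X ℝ →ₚ[ℝ] ℝ :=
    { toFun := fun φ => Λ φ.toContinuousMap
      map_add' := fun φ ψ => Λ.map_add φ.toContinuousMap ψ.toContinuousMap
      map_smul' := fun c φ => Λ.map_smul c φ.toContinuousMap
      monotone' := fun φ ψ h => by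
        rw [← sub_nonneg, ← map_sub]
        exact hnonneg _ fun x => sub_nonneg.2 (h x) }
  let ν := RealRMK.rieszMeasure Λc
  have hν (φ : C(X, ℝ)) : ∫ x, φ x ∂ν = Λ φ :=
    RealRMK.integral_rieszMeasure Λc ⟨φ, HasCompactSupport.of_compactSpace _⟩
  have hν_ne : ν ≠ 0 := fun h => by
    have hΛ_one := hν 1
    rw [h, integral_zero_measure] at hΛ_one
    exact (hΛ 1 fun _ => one_pos).ne hΛ_one
  have : NeZero ν := ⟨hν_ne⟩
  refine ⟨(ν Set.univ)⁻¹ • ν, isProbabilityMeasureSMul, ((ν Set.univ)⁻¹).toReal, fun φ => ?_⟩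
  rw [integral_smul_measure, hν, smul_eq_mul]

variable [Nonempty X]

theorem spectralRadius_eq_one_of_monotone (hL : Monotone L) (hu : ∀ x, 0 < u x)
    (hLu : L u = u) : spectralRadius ℝ L = 1 := by
  obtain ⟨δ, hδ, hδu⟩ := isCompact_univ.exists_forall_le' u.continuous.continuousOn
    fun x _ => hu x
  refine spectralRadius_eq_one_of_norm_pow_le (K := ‖u‖ / δ) (fun n => ?_) ?_ hLu
  · refine norm_le_of_monotone_of_apply_eq ?_ hδ (fun x => hδu x trivial) ?_
    · rw [FunLike.coe_pow_eq_iterate]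
      exact hL.iterate n
    · rw [FunLike.coe_pow_eq_iterate]
      exact Function.IsFixedPt.iterate hLu n
  · rintro rfl
    exact (hu (Classical.arbitrary X)).false

theorem exists_le_apply_of_monotone (hL : Monotone L) (hu : ∀ x, 0 < u x) (hLu : L u = u)
    (φ : C(X, ℝ)) : ∃ x, φ x ≤ L φ x := by
  obtain ⟨x, -, hx⟩ := isCompact_univ.exists_isMinOn Set.univ_nonempty
    (φ.continuous.div u.continuous fun x => (hu x).ne').continuousOn
  have hmin : (φ x / u x) • u ≤ φ := fun y => (le_div_iff₀ (hu y)).1 (hx (Set.mem_univ y))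
  have hLmin := hL hmin x
  rw [map_smul, hLu] at hLmin
  refine ⟨x, le_of_eq_of_le ?_ hLmin⟩
  simp [(hu x).ne']

-- Hahn–Banach: the range of `L - 1` misses the open convex cone of strictly negative functions.
theorem exists_invariant_functional_of_monotone (hL : Monotone L) (hu : ∀ x, 0 < u x)
    (hLu : L u = u) :
    ∃ Λ : C(X, ℝ) →L[ℝ] ℝ, (∀ φ, (∀ x, 0 < φ x) → 0 < Λ φ) ∧ ∀ φ, Λ (L φ) = Λ φ := by
  let N : Set C(X, ℝ) := {φ | ∀ x, φ x < 0}
  have hNconvex : Convex ℝ N := by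
    intro φ hφ ψ hψ a b ha hb hab x
    exact convex_Iio (0 : ℝ) (hφ x) (hψ x) ha hb hab
  have hNopen : IsOpen N := by
    simpa [Set.MapsTo, N] using
      ContinuousMap.isOpen_setOfPred_mapsTo (isCompact_univ (X := X)) (isOpen_Iio (a := (0 : ℝ)))
  have hdisj : Disjoint N (LinearMap.range (L - 1).toLinearMap : Set C(X, ℝ)) := by
    rw [Set.disjoint_left]
    rintro _ hφ ⟨φ, rfl⟩
    obtain ⟨x, hx⟩ := exists_le_apply_of_monotone hL hu hLu φ
    exact (sub_neg.1 (hφ x)).not_ge hx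
  obtain ⟨Λ, s, hΛN, hΛL⟩ := geometric_hahn_banach_open hNconvex hNopen
    (LinearMap.range (L - 1).toLinearMap).convex hdisj
  have hs : s ≤ 0 := by simpa using hΛL 0 (zero_mem _)
  have hzero (φ : C(X, ℝ)) : Λ ((L - 1) φ) = 0 := by
    by_contra hne
    have := hΛL _ ⟨((s - 1) / Λ ((L - 1) φ)) • φ, rfl⟩
    rw [ContinuousLinearMap.coe_coe, map_smul, map_smul, smul_eq_mul, div_mul_cancel₀ _ hne] at this
    linarith
  refine ⟨Λ, fun φ hφ => ?_, fun φ => ?_⟩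
  · have := hΛN (-φ) fun x => neg_neg_of_pos (hφ x)
    rw [map_neg] at this
    linarith
  · simpa [sub_eq_zero] using hzero φ

variable [T2Space X] [MeasurableSpace X] [BorelSpace X]

theorem exists_isProbabilityMeasure_integral_apply_eq (hL : Monotone L) (hu : ∀ x, 0 < u x)
    (hLu : L u = u) : ∃ μ : Measure X, IsProbabilityMeasure μ ∧
      ∀ φ : C(X, ℝ), ∫ x, L φ x ∂μ = ∫ x, φ x ∂μ := by
  obtain ⟨Λ, hΛpos, hΛL⟩ := exists_invariant_functional_of_monotone hL hu hLu
  obtain ⟨μ, hμ, c, hc⟩ := exists_isProbabilityMeasure_integral_eq_mul hΛpos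
  exact ⟨μ, hμ, fun φ => by rw [hc, hc, hΛL]⟩

end PositiveOperators

section MartingaleApproximation

open Finset InnerProductSpace
open scoped RealInnerProductSpace

variable {H : Type*} [NormedAddCommGroup H] [InnerProductSpace ℝ H] (U : H →ₗᵢ[ℝ] H)

theorem norm_sum_iterate_sq_of_inner_eq_zero {d : H} (hd : ∀ h, ⟪d, U h⟫ = 0) (n : ℕ) :
    ‖∑ i ∈ range n, U^[i] d‖ ^ 2 = n * ‖d‖ ^ 2 := by
  induction n with
  | zero => simp
  | succ n ih =>
    have hsplit : ∑ i ∈ range (n + 1), U^[i] d = U (∑ i ∈ range n, U^[i] d) + d := by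
      simp only [sum_range_succ', Function.iterate_succ_apply', map_sum,
        Function.iterate_zero_apply]
    rw [hsplit, norm_add_sq_real, real_inner_comm, hd, U.norm_map, ih]
    push_cast
    ring

theorem sum_iterate_sub_apply (z z' : H) (n : ℕ) :
    ∑ i ∈ range n, U^[i] (z - z') = ∑ i ∈ range n, U^[i] (z - U z') + (U^[n] z' - z') := by
  induction n with
  | zero => simp
  | succ n ih =>
    have hstep : U^[n] (z - z') = U^[n] (z - U z') + (U^[n + 1] z' - U^[n] z') := by
      simp only [Function.iterate_succ_apply, ← LinearIsometry.coe_pow, map_sub]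
      abel
    rw [sum_range_succ, sum_range_succ, ih, hstep]
    abel

variable {U}

-- Gordin's decomposition: up to the coboundary `U z' - z'`, the vector `z - z'` is `z - U z'`,
-- whose iterates under `U` are orthogonal.
theorem tendsto_norm_sum_iterate_sq_div {z z' : H} (hz : ∀ h, ⟪z, U h⟫ = ⟪z', h⟫) :
    Tendsto (fun n : ℕ => ‖∑ i ∈ range n, U^[i] (z - z')‖ ^ 2 / n) atTop
      (𝓝 (‖z‖ ^ 2 - ‖z'‖ ^ 2)) := by
  set d := z - U z'
  have hd (h : H) : ⟪d, U h⟫ = 0 := by rw [inner_sub_left, hz, U.inner_map_map, sub_self]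
  have hnorm : ‖d‖ ^ 2 = ‖z‖ ^ 2 - ‖z'‖ ^ 2 := by
    rw [norm_sub_sq_real, hz, real_inner_self_eq_norm_sq, U.norm_map]
    ring
  rw [← hnorm]
  have hmain (n : ℕ) : ‖∑ i ∈ range n, U^[i] d‖ = √n * ‖d‖ := by
    rw [← Real.sqrt_sq (norm_nonneg (∑ i ∈ range n, U^[i] d)),
      norm_sum_iterate_sq_of_inner_eq_zero U hd, Real.sqrt_mul n.cast_nonneg,
      Real.sqrt_sq (norm_nonneg d)]
  have herror (n : ℕ) : |‖∑ i ∈ range n, U^[i] (z - z')‖ - √n * ‖d‖| ≤ 2 * ‖z'‖ :=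
    calc |‖∑ i ∈ range n, U^[i] (z - z')‖ - √n * ‖d‖|
        ≤ ‖U^[n] z' - z'‖ := by
          rw [← hmain]
          refine (abs_norm_sub_norm_le _ _).trans_eq ?_
          rw [sum_iterate_sub_apply, add_sub_cancel_left]
      _ ≤ ‖U^[n] z'‖ + ‖z'‖ := norm_sub_le _ _
      _ = 2 * ‖z'‖ := by rw [← LinearIsometry.coe_pow, LinearIsometry.norm_map, two_mul]
  have hsqrt : Tendsto (fun n : ℕ => √(n : ℝ)) atTop atTop :=
    Real.tendsto_sqrt_atTop.comp tendsto_natCast_atTop_atTop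
  have hlim : Tendsto (fun n : ℕ => ‖∑ i ∈ range n, U^[i] (z - z')‖ / √n) atTop (𝓝 ‖d‖) := by
    rw [tendsto_iff_norm_sub_tendsto_zero]
    refine squeeze_zero' (.of_forall fun n => norm_nonneg _) ?_
      (tendsto_const_nhds (x := 2 * ‖z'‖).div_atTop hsqrt)
    filter_upwards [eventually_gt_atTop 0] with n hn
    have hn : 0 < √(n : ℝ) := by positivity
    rw [div_sub' hn.ne', norm_div, Real.norm_of_nonneg hn.le, Real.norm_eq_abs]
    gcongr
    exact herror n
  refine (hlim.pow 2).congr fun n => ?_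
  rw [div_pow, Real.sq_sqrt n.cast_nonneg]

variable {X : Type*} [TopologicalSpace X] [CompactSpace X] [NormalSpace X] [MeasurableSpace X]
  [BorelSpace X] {m : Measure X} [IsFiniteMeasure m]

theorem tendsto_integral_birkhoffSum_sq [m.WeaklyRegular] {T : X → X} (hT : Continuous T)
    (hTm : MeasurePreserving T m m) {z z' : C(X, ℝ)}
    (hz : ∀ φ : C(X, ℝ), ∫ x, z x * φ (T x) ∂m = ∫ x, z' x * φ x ∂m) :
    Tendsto (fun n : ℕ => (∫ x, birkhoffSum T (z - z') n x ^ 2 ∂m) / n) atTop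
      (𝓝 (∫ x, z x ^ 2 ∂m - ∫ x, z' x ^ 2 ∂m)) := by
  let U := Lp.compMeasurePreservingₗᵢ ℝ T hTm (E := ℝ) (p := 2)
  let ofC := ContinuousMap.toLp (E := ℝ) 2 m ℝ
  have hnorm (φ : C(X, ℝ)) : ‖ofC φ‖ ^ 2 = ∫ x, φ x ^ 2 ∂m := by
    rw [← real_inner_self_eq_norm_sq, ContinuousMap.inner_toLp]
    simp [sq]
  have hU (φ : C(X, ℝ)) : U (ofC φ) = ofC (φ.comp ⟨T, hT⟩) := rfl
  have hiterate (φ : C(X, ℝ)) (i : ℕ) : U^[i] (ofC φ) = ofC (φ.comp ⟨T^[i], hT.iterate i⟩) := by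
    induction i generalizing φ with
    | zero => rfl
    | succ i ih =>
      rw [Function.iterate_succ_apply, hU, ih]
      congr 1
      ext x
      exact congrArg φ (Function.iterate_succ_apply' T i x).symm
  have hdual (h : Lp ℝ 2 m) : ⟪ofC z, U h⟫ = ⟪ofC z', h⟫ := by
    refine (ContinuousMap.toLp_denseRange (p := 2) ℝ m ℝ ENNReal.ofNat_ne_top).induction_on h
      (isClosed_eq (by fun_prop) (by fun_prop)) fun φ => ?_
    rw [hU, ContinuousMap.inner_toLp, ContinuousMap.inner_toLp]
    simpa [mul_comm] using hz φ
  have hlim := tendsto_norm_sum_iterate_sq_div hdual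
  rw [hnorm, hnorm] at hlim
  refine hlim.congr fun n => ?_
  simp only [← map_sub, hiterate, ← map_sum, hnorm]
  simp [birkhoffSum]

end MartingaleApproximation

section Perron

open Matrix

variable {ι : Type*} {M : Matrix ι ι ℝ}

theorem forall_of_isIrreducible (hM : M.IsIrreducible) {P : ι → Prop}
    (hstep : ∀ i j, 0 < M i j → P i → P j) {i : ι} (hi : P i) (j : ι) : P j := by
  let := toQuiver M
  obtain ⟨path, -⟩ := hM.connected i j
  induction path with
  | nil => exact hi
  | cons _ e ih => exact hstep _ _ e.down ih

variable [Fintype ι] {c : ℝ} {p r : ι → ℝ}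

theorem eq_zero_of_mulVec_eq_smul (hM : M.IsIrreducible) (hp : ∀ i, 0 ≤ p i)
    (hMp : M *ᵥ p = c • p) {i : ι} (hi : p i = 0) : p = 0 := by
  refine funext (forall_of_isIrreducible (P := fun i => p i = 0) hM (fun i j hij hi => ?_) hi)
  have hsum : ∑ j, M i j * p j = 0 := (congrFun hMp i).trans (by simp [hi])
  rw [Finset.sum_eq_zero_iff_of_nonneg fun j _ => mul_nonneg (hM.nonneg i j) (hp j)] at hsum
  exact (mul_eq_zero.1 (hsum j (Finset.mem_univ j))).resolve_left hij.ne'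

theorem exists_eq_smul_of_mulVec_eq_smul [Nonempty ι] (hM : M.IsIrreducible) (hr : ∀ i, 0 < r i)
    (hMr : M *ᵥ r = c • r) (hMp : M *ᵥ p = c • p) : ∃ k : ℝ, p = k • r := by
  obtain ⟨i, hi⟩ := Finite.exists_max fun i => p i / r i
  set k := p i / r i with hk
  have hnonneg (j : ι) : 0 ≤ (k • r - p) j :=
    sub_nonneg.2 ((div_le_iff₀ (hr j)).1 (hi j))
  have heigen : M *ᵥ (k • r - p) = c • (k • r - p) := by
    rw [mulVec_sub, mulVec_smul, hMr, hMp, smul_comm, smul_sub]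
  refine ⟨k, (sub_eq_zero.1 (eq_zero_of_mulVec_eq_smul hM hnonneg heigen (i := i) ?_)).symm⟩
  simp [hk, (hr i).ne']

end Perron

namespace Subshift

variable {ι : Type*} {A : Matrix ι ι ℕ}

/-- Irreducibility of a `0`-`1` matrix: any letter can be joined to any letter by an admissible
word. -/
def IsIrreducible (A : Matrix ι ι ℕ) : Prop :=
  ∀ i j, Relation.TransGen (fun i j => A i j = 1) i j

open Fin.NatCast in
theorem isIrreducible_of_cycle {n : ℕ} [NeZero n] {c : Fin n → ι} (hc : Function.Surjective c)
    (hA : ∀ i, A (c i) (c (i + 1)) = 1) : IsIrreducible A := by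
  have hstep (i : Fin n) (k : ℕ) :
      Relation.TransGen (fun i j => A i j = 1) (c i) (c (i + 1 + (k : Fin n))) := by
    induction k with
    | zero => simpa using .single (hA i)
    | succ k ih => simpa [add_assoc] using ih.tail (hA _)
  refine hc.forall₂.2 fun i j => ?_
  simpa using hstep i (j - (i + 1) : Fin n).val

/-- The matrix whose action on row vectors is the transfer operator of `x ↦ F x₀` on functions of
the zeroth letter, see `transferOp_letterFun`. -/
noncomputable def weightMatrix (A : Matrix ι ι ℕ) (F : ι → ℝ) : Matrix ι ι ℝ :=
  .of fun i j => if A i j = 1 then Real.exp (F i) else 0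

theorem weightMatrix_apply (F : ι → ℝ) (i j : ι) :
    weightMatrix A F i j = if A i j = 1 then Real.exp (F i) else 0 := rfl

theorem weightMatrix_pos_iff {F : ι → ℝ} {i j : ι} : 0 < weightMatrix A F i j ↔ A i j = 1 := by
  rw [weightMatrix_apply]
  split_ifs with h <;> simp [h, Real.exp_pos]

theorem weightMatrix_nonneg (F : ι → ℝ) (i j : ι) : 0 ≤ weightMatrix A F i j := by
  rw [weightMatrix_apply]
  positivity

theorem IsIrreducible.weightMatrix (hA : IsIrreducible A) (F : ι → ℝ) :
    (weightMatrix A F).IsIrreducible := by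
  refine ⟨weightMatrix_nonneg F, ?_⟩
  let := Matrix.toQuiver (Subshift.weightMatrix A F)
  intro i j
  induction hA i j with
  | single h => exact ⟨Quiver.Hom.toPath ⟨weightMatrix_pos_iff.2 h⟩, by simp⟩
  | tail _ h ih => exact ⟨ih.choose.cons ⟨weightMatrix_pos_iff.2 h⟩, by simp⟩

@[simp] theorem cons_zero (i : ι) (x : Subshift A) (h : A i (x.1 0) = 1) :
    (cons i x h).1 0 = i := rfl

@[simp] theorem shift_cons (i : ι) (x : Subshift A) (h : A i (x.1 0) = 1) :
    shift (cons i x h) = x := rfl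

theorem exists_mem_forall_le_eq_of_cons_mem (hA : IsIrreducible A) {Z : Set (Subshift A)}
    (hne : Z.Nonempty) (hcons : ∀ x ∈ Z, ∀ i (h : A i (x.1 0) = 1), cons i x h ∈ Z) (n : ℕ)
    (y : Subshift A) : ∃ z ∈ Z, ∀ k ≤ n, z.1 k = y.1 k := by
  induction n generalizing y with
  | zero =>
    simp only [Nat.le_zero, forall_eq]
    obtain ⟨x, hx⟩ := hne
    generalize y.1 0 = i
    induction hA i (x.1 0) using Relation.TransGen.head_induction_on with
    | single h => exact ⟨_, hcons x hx _ h, rfl⟩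
    | head h _ ih =>
      obtain ⟨z, hz, rfl⟩ := ih
      exact ⟨_, hcons z hz _ h, rfl⟩
  | succ n ih =>
    obtain ⟨z, hz, hzy⟩ := ih y.shift
    have hy : A (y.1 0) (z.1 0) = 1 := (hzy 0 n.zero_le) ▸ y.2 0
    refine ⟨cons (y.1 0) z hy, hcons z hz _ hy, fun k hk => ?_⟩
    cases k with
    | zero => rfl
    | succ k => exact hzy k (Nat.le_of_succ_le_succ hk)

variable [TopologicalSpace ι]

theorem continuous_shift : Continuous (shift : Subshift A → Subshift A) :=
  Continuous.subtype_mk (f := fun (x : Subshift A) n => x.1 (n + 1)) (continuous_pi fun n =>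
    (continuous_apply (A := fun _ : ℕ => ι) (n + 1)).comp continuous_subtype_val) _

theorem eq_univ_of_cons_mem (hA : IsIrreducible A) {Z : Set (Subshift A)} (hZ : IsClosed Z)
    (hne : Z.Nonempty) (hcons : ∀ x ∈ Z, ∀ i (h : A i (x.1 0) = 1), cons i x h ∈ Z) :
    Z = Set.univ := by
  refine Set.eq_univ_of_forall fun y => ?_
  choose z hz hzy using fun n => exists_mem_forall_le_eq_of_cons_mem hA hne hcons n y
  refine hZ.mem_of_tendsto (b := atTop) (f := z) ?_ (.of_forall hz)
  rw [tendsto_subtype_rng, tendsto_pi_nhds]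
  intro k
  refine tendsto_const_nhds.congr' ?_
  filter_upwards [eventually_ge_atTop k] with n hnk
  exact (hzy n k hnk).symm

variable [DiscreteTopology ι]

/-- The function `x ↦ g x₀` of the zeroth letter. -/
def letterFun (A : Matrix ι ι ℕ) (g : ι → ℝ) : C(Subshift A, ℝ) where
  toFun x := g (x.1 0)
  continuous_toFun := (continuous_of_discreteTopology (f := g)).comp
    ((continuous_apply 0).comp continuous_subtype_val)

@[simp] theorem letterFun_apply (g : ι → ℝ) (x : Subshift A) :
    letterFun A g x = g (x.1 0) := rfl

theorem letterFun_mul (g g' : ι → ℝ) :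
    letterFun A (g * g') = letterFun A g * letterFun A g' := rfl

theorem letterFun_sub (g g' : ι → ℝ) :
    letterFun A (g - g') = letterFun A g - letterFun A g' := rfl

end Subshift

section Transfer

open Subshift

variable {ι : Type*} [TopologicalSpace ι] [DiscreteTopology ι] [Fintype ι] {A : Matrix ι ι ℕ}
  {f u v : C(Subshift A, ℝ)}

theorem transferOp_apply (f w : C(Subshift A, ℝ)) (x : Subshift A) :
    transferOp f w x = ∑ i : ι, if h : A i (x.1 0) = 1 then
      Real.exp (f (cons i x h)) * w (cons i x h) else 0 := rfl

theorem transferOp_mul_comp_shift (f w φ : C(Subshift A, ℝ)) :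
    transferOp f (w * φ.comp ⟨shift, continuous_shift⟩) = transferOp f w * φ := by
  ext x
  simp only [transferOp_apply, ContinuousMap.mul_apply, ContinuousMap.comp_apply,
    ContinuousMap.coe_mk, shift_cons, Finset.sum_mul]
  refine Finset.sum_congr rfl fun i _ => ?_
  split_ifs <;> ring

theorem transferOp_letterFun (F w : ι → ℝ) :
    transferOp (letterFun A F) (letterFun A w) =
      letterFun A (Matrix.vecMul w (weightMatrix A F)) := by
  ext x
  simp [transferOp_apply, Matrix.vecMul, dotProduct, weightMatrix_apply, mul_comm]

theorem monotone_transferOp (f : C(Subshift A, ℝ)) : Monotone (transferOp f) := by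
  intro w w' hw x
  refine Finset.sum_le_sum fun i _ => ?_
  split_ifs
  · gcongr
    exact hw _
  · rfl

theorem apply_cons_eq_zero_of_transferOp_eq (hu : ∀ x, 0 ≤ u x) (hfu : transferOp f u = u)
    {x : Subshift A} (hx : u x = 0) {i : ι} (hi : A i (x.1 0) = 1) : u (cons i x hi) = 0 := by
  rw [← hfu, transferOp_apply, Finset.sum_eq_zero_iff_of_nonneg] at hx
  · have hterm := hx i (Finset.mem_univ i)
    rw [dif_pos hi] at hterm
    exact (mul_eq_zero.1 hterm).resolve_left (Real.exp_ne_zero _)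
  · intro j _
    split_ifs with h
    · exact mul_nonneg (Real.exp_nonneg _) (hu _)
    · rfl

theorem eq_zero_of_transferOp_eq (hA : IsIrreducible A) (hu : ∀ x, 0 ≤ u x)
    (hfu : transferOp f u = u) {x : Subshift A} (hx : u x = 0) : u = 0 := by
  have hzero : {x | u x = 0} = Set.univ :=
    eq_univ_of_cons_mem hA (isClosed_eq u.continuous continuous_const) ⟨x, hx⟩
      fun y hy i hi => apply_cons_eq_zero_of_transferOp_eq hu hfu hy hi
  ext y
  exact hzero.symm.subset (Set.mem_univ y)

variable [Nonempty (Subshift A)]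

theorem exists_eq_smul_of_transferOp_eq (hA : IsIrreducible A) (hu : ∀ x, 0 < u x)
    (hfu : transferOp f u = u) (hfv : transferOp f v = v) : ∃ c : ℝ, v = c • u := by
  obtain ⟨x, -, hx⟩ := isCompact_univ.exists_isMaxOn Set.univ_nonempty
    (v.continuous.div u.continuous fun x => (hu x).ne').continuousOn
  set c := v x / u x with hc
  have hnonneg (y : Subshift A) : 0 ≤ (c • u - v) y :=
    sub_nonneg.2 ((div_le_iff₀ (hu y)).1 (hx (Set.mem_univ y)))
  have hfixed : transferOp f (c • u - v) = c • u - v := by rw [map_sub, map_smul, hfu, hfv]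
  refine ⟨c, (sub_eq_zero.1 (eq_zero_of_transferOp_eq hA hnonneg hfixed (x := x) ?_)).symm⟩
  simp [hc, (hu x).ne']

theorem perronValue_eq_one (hu : ∀ x, 0 < u x) (hfu : transferOp f u = u) : perronValue f = 1 := by
  rw [perronValue, spectralRadius_eq_one_of_monotone (monotone_transferOp f) hu hfu,
    ENNReal.toReal_one]

end Transfer

theorem isPiSystem_piNat_cylinders (E : ℕ → Type*) :
    IsPiSystem {s : Set (∀ n, E n) | ∃ x n, s = PiNat.cylinder x n} := by
  rintro _ ⟨x, m, rfl⟩ _ ⟨y, n, rfl⟩ ⟨z, hzx, hzy⟩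
  refine ⟨z, max m n, ?_⟩
  rw [← PiNat.mem_cylinder_iff_eq.1 hzx, ← PiNat.mem_cylinder_iff_eq.1 hzy]
  ext w
  simp only [Set.mem_inter_iff, PiNat.mem_cylinder_iff, lt_max_iff, or_imp, forall_and]

namespace Subshift

variable {ι : Type*} [MeasurableSpace ι] {A : Matrix ι ι ℕ}

theorem measurableSet_apply_eq [MeasurableSingletonClass ι] (n : ℕ) (i : ι) :
    MeasurableSet {x : Subshift A | x.1 n = i} :=
  ((measurable_pi_apply n).comp measurable_subtype_coe :
    Measurable fun x : Subshift A => x.1 n) (measurableSet_singleton i)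

variable [Finite ι] [TopologicalSpace ι] [DiscreteTopology ι]

instance secondCountableTopology : SecondCountableTopology (Subshift A) := by
  have : Countable ι := inferInstance
  have : SecondCountableTopology ι := inferInstance
  exact IsInducing.subtypeVal.secondCountableTopology

variable [DiscreteMeasurableSpace ι]

instance borelSpace : BorelSpace (Subshift A) := by
  have : Countable ι := inferInstance
  have : SecondCountableTopology ι := inferInstance
  have : BorelSpace ι := inferInstance
  infer_instance

theorem integrable (m : Measure (Subshift A)) [IsFiniteMeasure m]
    (φ : C(Subshift A, ℝ)) : Integrable φ m :=
  φ.continuous.integrable_of_hasCompactSupport (HasCompactSupport.of_compactSpace _)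

theorem ext_of_measureReal_cylinder {μ ν : Measure (Subshift A)} [IsProbabilityMeasure μ]
    [IsProbabilityMeasure ν] (h : ∀ (y : Subshift A) (n : ℕ),
      μ.real {x | ∀ k ≤ n, x.1 k = y.1 k} = ν.real {x | ∀ k ≤ n, x.1 k = y.1 k}) : μ = ν := by
  let C : Set (Set (ℕ → ι)) := {s | ∃ x n, s = PiNat.cylinder x n}
  have hbasis : TopologicalSpace.IsTopologicalBasis
      (Set.preimage (Subtype.val : Subshift A → ℕ → ι) '' C) :=
    (PiNat.isTopologicalBasis_cylinders fun _ : ℕ => ι).isInducing .subtypeVal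
  have hgen := (BorelSpace.measurable_eq (α := Subshift A)).trans hbasis.borel_eq_generateFrom
  refine ext_of_generate_finite _ hgen ((isPiSystem_piNat_cylinders _).comap Subtype.val) ?_
    (by simp)
  rintro _ ⟨_, ⟨x, n, rfl⟩, rfl⟩
  rcases Set.eq_empty_or_nonempty ((Subtype.val : Subshift A → ℕ → ι) ⁻¹' PiNat.cylinder x n)
    with hempty | ⟨y, hy⟩
  · simp [hempty]
  · rw [← PiNat.mem_cylinder_iff_eq.1 hy]
    cases n with
    | zero => simp
    | succ n =>
      have hreal := (ENNReal.toReal_eq_toReal_iff' (by finiteness) (by finiteness)).1 (h y n)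
      simpa [PiNat.cylinder, Nat.lt_succ_iff] using hreal

end Subshift

section ConformalMeasure

open Subshift Matrix

variable {ι : Type*} [TopologicalSpace ι] [DiscreteTopology ι] {A : Matrix ι ι ℕ}

/-- The masses that a measure gives to the letters, that is, to the sets `{x | x₀ = i}`. -/
noncomputable def letterMass [MeasurableSpace ι] (m : Measure (Subshift A)) (i : ι) : ℝ :=
  m.real {x | x.1 0 = i}

theorem Subshift.isClopen_cylinder (y : Subshift A) (n : ℕ) :
    IsClopen {x : Subshift A | ∀ k ≤ n, x.1 k = y.1 k} := by
  have heq : {x : Subshift A | ∀ k ≤ n, x.1 k = y.1 k} =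
      ⋂ k ∈ Finset.range (n + 1), (fun x : Subshift A => x.1 k) ⁻¹' {y.1 k} := by
    ext x
    simp
  rw [heq]
  exact isClopen_biInter_finset fun k _ => (isClopen_discrete _).preimage
    ((continuous_apply (A := fun _ : ℕ => ι) k).comp continuous_subtype_val)

/-- The indicator function of the cylinder of the sequences that agree with `y` up to the index
`n`. -/
noncomputable def Subshift.cylinderFun (y : Subshift A) (n : ℕ) : C(Subshift A, ℝ) where
  toFun := Set.indicator {x | ∀ k ≤ n, x.1 k = y.1 k} 1
  continuous_toFun := (isClopen_cylinder y n).continuous_indicator continuous_one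

theorem Subshift.cylinderFun_succ [DecidableEq ι] (y : Subshift A) (n : ℕ) :
    cylinderFun y (n + 1) = letterFun A (Pi.single (y.1 0) 1) *
      (cylinderFun y.shift n).comp ⟨shift, continuous_shift⟩ := by
  classical
  ext x
  have hsucc : (∀ k ≤ n + 1, x.1 k = y.1 k) ↔
      (∀ k ≤ n, x.shift.1 k = y.shift.1 k) ∧ x.1 0 = y.1 0 :=
    ⟨fun h => ⟨fun k hk => h _ (by lia), h 0 (by lia)⟩, fun h k hk => by
      cases k with
      | zero => exact h.2
      | succ k => exact h.1 k (by lia)⟩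
  simp [cylinderFun, Set.indicator_apply, hsucc, ite_and, Pi.single_apply]

theorem integral_cylinderFun [Finite ι] [MeasurableSpace ι]
    [DiscreteMeasurableSpace ι] (m : Measure (Subshift A)) (y : Subshift A) (n : ℕ) :
    ∫ x, cylinderFun y n x ∂m = m.real {x | ∀ k ≤ n, x.1 k = y.1 k} :=
  integral_indicator_one (isClopen_cylinder y n).isOpen.measurableSet

variable [Fintype ι] {F r : ι → ℝ}

theorem transferOp_cylinderFun_succ (F : ι → ℝ) (y : Subshift A) (n : ℕ) :
    transferOp (letterFun A F) (cylinderFun y (n + 1)) =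
      Real.exp (F (y.1 0)) • cylinderFun y.shift n := by
  classical
  rw [cylinderFun_succ, transferOp_mul_comp_shift, transferOp_letterFun]
  ext x
  by_cases hx : ∀ k ≤ n, x.1 k = y.shift.1 k
  · have hx0 : x.1 0 = y.1 1 := hx 0 n.zero_le
    simp [weightMatrix_apply, hx0, y.2 0]
  · simp [cylinderFun, hx]

variable [MeasurableSpace ι] [DiscreteMeasurableSpace ι]

/-- A probability measure that is fixed by the dual of the transfer operator of `f`. -/
structure IsConformalMeasure (f : C(Subshift A, ℝ)) (μ : Measure (Subshift A)) : Prop where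
  isProbabilityMeasure : IsProbabilityMeasure μ
  integral_transferOp (φ : C(Subshift A, ℝ)) : ∫ x, transferOp f φ x ∂μ = ∫ x, φ x ∂μ

theorem integral_letterFun (m : Measure (Subshift A)) [IsFiniteMeasure m] (g : ι → ℝ) :
    ∫ x, letterFun A g x ∂m = g ⬝ᵥ letterMass m := by
  classical
  have hsum (x : Subshift A) : letterFun A g x =
      ∑ i, g i * Set.indicator {x : Subshift A | x.1 0 = i} 1 x := by
    simp [Set.indicator_apply]
  have hint (i : ι) : Integrable ({x : Subshift A | x.1 0 = i}.indicator 1 : _ → ℝ) m :=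
    (integrable_const (1 : ℝ)).indicator (measurableSet_apply_eq 0 i)
  calc ∫ x, letterFun A g x ∂m
      = ∫ x, ∑ i, g i * Set.indicator {x : Subshift A | x.1 0 = i} 1 x ∂m :=
        integral_congr_ae (.of_forall hsum)
    _ = ∑ i, ∫ x, g i * Set.indicator {x : Subshift A | x.1 0 = i} 1 x ∂m :=
        integral_finsetSum _ fun i _ => (hint i).const_mul _
    _ = g ⬝ᵥ letterMass m := Finset.sum_congr rfl fun i _ => by
        rw [integral_const_mul, integral_indicator_one (measurableSet_apply_eq 0 i), letterMass]

namespace IsConformalMeasure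

variable {μ ν : Measure (Subshift A)}

theorem measureReal_cylinder (hμ : IsConformalMeasure (letterFun A F) μ) (y : Subshift A) (n : ℕ) :
    μ.real {x | ∀ k ≤ n, x.1 k = y.1 k} =
      Real.exp (∑ k ∈ Finset.range n, F (y.1 k)) * letterMass μ (y.1 n) := by
  induction n generalizing y with
  | zero => simp [letterMass]
  | succ n ih =>
    rw [← integral_cylinderFun, ← hμ.integral_transferOp, transferOp_cylinderFun_succ,
      Finset.sum_range_succ', add_comm, Real.exp_add, mul_assoc]
    simp only [ContinuousMap.smul_apply, smul_eq_mul, integral_const_mul, integral_cylinderFun, ih]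
    rfl

theorem mulVec_letterMass (hμ : IsConformalMeasure (letterFun A F) μ) :
    weightMatrix A F *ᵥ letterMass μ = letterMass μ := by
  have := hμ.isProbabilityMeasure
  refine dotProduct_eq _ _ fun g => ?_
  rw [dotProduct_comm, dotProduct_mulVec, ← integral_letterFun, ← transferOp_letterFun,
    hμ.integral_transferOp, integral_letterFun, dotProduct_comm]

theorem letterMass_eq (hA : IsIrreducible A) (hr : ∀ i, 0 < r i)
    (hWr : weightMatrix A F *ᵥ r = r) (hμ : IsConformalMeasure (letterFun A F) μ) :
    letterMass μ = (∑ i, r i)⁻¹ • r := by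
  have := hμ.isProbabilityMeasure
  obtain ⟨x⟩ := μ.nonempty_of_neZero
  have : Nonempty ι := ⟨x.1 0⟩
  obtain ⟨k, hk⟩ := exists_eq_smul_of_mulVec_eq_smul (hA.weightMatrix F) hr
    (hWr.trans (one_smul ℝ r).symm) (hμ.mulVec_letterMass.trans (one_smul ℝ _).symm)
  have htotal : k * ∑ i, r i = 1 := by
    have h := integral_letterFun μ 1
    simp only [letterFun_apply, Pi.one_apply, integral_const, probReal_univ, hk,
      one_dotProduct, Pi.smul_apply, smul_eq_mul, ← Finset.mul_sum, mul_one] at h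
    exact h.symm
  rw [hk, eq_inv_of_mul_eq_one_left htotal]

theorem unique (hA : IsIrreducible A) (hr : ∀ i, 0 < r i) (hWr : weightMatrix A F *ᵥ r = r)
    (hμ : IsConformalMeasure (letterFun A F) μ) (hν : IsConformalMeasure (letterFun A F) ν) :
    μ = ν := by
  have := hμ.isProbabilityMeasure
  have := hν.isProbabilityMeasure
  refine ext_of_measureReal_cylinder fun y n => ?_
  rw [hμ.measureReal_cylinder, hν.measureReal_cylinder, hμ.letterMass_eq hA hr hWr,
    hν.letterMass_eq hA hr hWr]

end IsConformalMeasure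

theorem exists_isConformalMeasure [Nonempty (Subshift A)] {f u : C(Subshift A, ℝ)}
    (hu : ∀ x, 0 < u x) (hfu : transferOp f u = u) : ∃ μ, IsConformalMeasure f μ :=
  (exists_isProbabilityMeasure_integral_apply_eq (monotone_transferOp f) hu hfu).imp
    fun _ hμ => ⟨hμ.1, hμ.2⟩

end ConformalMeasure

theorem integral_tilted_log {α : Type*} [MeasurableSpace α] {u : α → ℝ} (hu : ∀ x, 0 < u x)
    (μ : Measure α) (φ : α → ℝ) :
    ∫ x, φ x ∂μ.tilted (fun x => Real.log (u x)) = (∫ x, φ x * u x ∂μ) / ∫ x, u x ∂μ := by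
  simp only [integral_tilted, Real.exp_log (hu _), smul_eq_mul, div_mul_eq_mul_div, integral_div,
    mul_comm (φ _)]

section EquilibriumState

open Subshift Matrix

variable {ι : Type*} [TopologicalSpace ι] [DiscreteTopology ι] [Fintype ι] [MeasurableSpace ι]
  [DiscreteMeasurableSpace ι] {A : Matrix ι ι ℕ} [Nonempty (Subshift A)]
  {f u w w' z z' : C(Subshift A, ℝ)} {m : Measure (Subshift A)} {F q r : ι → ℝ}

theorem isEquilibriumState_iff (hA : IsIrreducible A) (hu : ∀ x, 0 < u x)
    (hfu : transferOp f u = u) :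
    IsEquilibriumState f m ↔
      ∃ μ, IsConformalMeasure f μ ∧ m = μ.tilted fun x => Real.log (u x) := by
  simp only [IsEquilibriumState, pressure, perronValue_eq_one hu hfu, Real.log_one, true_and,
    one_smul, one_mul, Measure.tilted, Real.exp_log (hu _)]
  constructor
  · rintro ⟨v, μ, hv, hfv, hμ, hμf, rfl⟩
    obtain ⟨c, rfl⟩ := exists_eq_smul_of_transferOp_eq hA hu hfu hfv
    have hc : c ≠ 0 := by
      rintro rfl
      simpa using hv (Classical.arbitrary _)
    refine ⟨μ, ⟨hμ, hμf⟩, ?_⟩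
    simp only [ContinuousMap.smul_apply, smul_eq_mul, integral_const_mul, mul_div_mul_left _ _ hc]
  · rintro ⟨μ, hμ, rfl⟩
    exact ⟨u, μ, hu, hfu, hμ.isProbabilityMeasure, hμ.integral_transferOp, rfl⟩

theorem existsUnique_isEquilibriumState (hA : IsIrreducible A) (hq : ∀ i, 0 < q i)
    (hqW : q ᵥ* weightMatrix A F = q) (hr : ∀ i, 0 < r i) (hWr : weightMatrix A F *ᵥ r = r) :
    ∃! m, IsEquilibriumState (letterFun A F) m := by
  have hu (x : Subshift A) : 0 < letterFun A q x := hq _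
  have hfu : transferOp (letterFun A F) (letterFun A q) = letterFun A q := by
    rw [transferOp_letterFun, hqW]
  simp only [isEquilibriumState_iff hA hu hfu]
  obtain ⟨μ, hμ⟩ := exists_isConformalMeasure hu hfu
  refine ⟨_, ⟨μ, hμ, rfl⟩, ?_⟩
  rintro _ ⟨ν, hν, rfl⟩
  rw [hν.unique hA hr hWr hμ]

namespace IsEquilibriumState

theorem isProbabilityMeasure (hA : IsIrreducible A) (hu : ∀ x, 0 < u x)
    (hfu : transferOp f u = u) (hm : IsEquilibriumState f m) : IsProbabilityMeasure m := by
  obtain ⟨μ, hμ, rfl⟩ := (isEquilibriumState_iff hA hu hfu).1 hm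
  have := hμ.isProbabilityMeasure
  refine isProbabilityMeasure_tilted ?_
  simpa only [Real.exp_log (hu _)] using integrable μ u

theorem integral_mul_comp_shift (hA : IsIrreducible A) (hu : ∀ x, 0 < u x)
    (hfu : transferOp f u = u) (hm : IsEquilibriumState f m)
    (hw : transferOp f (w * u) = w' * u) (φ : C(Subshift A, ℝ)) :
    ∫ x, w x * φ x.shift ∂m = ∫ x, w' x * φ x ∂m := by
  obtain ⟨μ, hμ, rfl⟩ := (isEquilibriumState_iff hA hu hfu).1 hm
  rw [integral_tilted_log hu, integral_tilted_log hu]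
  congr 1
  calc ∫ x, w x * φ x.shift * u x ∂μ
      = ∫ x, (w * u * φ.comp ⟨shift, continuous_shift⟩) x ∂μ := by
        simp [mul_right_comm]
    _ = ∫ x, (w' * u * φ) x ∂μ := by
        rw [← hμ.integral_transferOp, transferOp_mul_comp_shift, hw]
    _ = ∫ x, w' x * φ x * u x ∂μ := by
        simp [mul_right_comm]

theorem measurePreserving_shift (hA : IsIrreducible A) (hu : ∀ x, 0 < u x)
    (hfu : transferOp f u = u) (hm : IsEquilibriumState f m) :
    MeasurePreserving Subshift.shift m m := by
  have := hm.isProbabilityMeasure hA hu hfu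
  refine ⟨continuous_shift.measurable, ?_⟩
  have := Measure.isProbabilityMeasure_map (μ := m) (continuous_shift (A := A)).aemeasurable
  refine ext_of_forall_integral_eq_of_IsFiniteMeasure fun φ => ?_
  rw [integral_map continuous_shift.aemeasurable φ.continuous.aestronglyMeasurable]
  simpa using hm.integral_mul_comp_shift hA hu hfu (w := 1) (w' := 1) (by rwa [one_mul])
    φ.toContinuousMap

theorem integral_sub_eq_zero (hA : IsIrreducible A) (hu : ∀ x, 0 < u x)
    (hfu : transferOp f u = u) (hm : IsEquilibriumState f m)
    (hz : transferOp f (z * u) = z' * u) : ∫ x, (z - z') x ∂m = 0 := by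
  have := hm.isProbabilityMeasure hA hu hfu
  have heq := hm.integral_mul_comp_shift hA hu hfu hz 1
  simp only [ContinuousMap.one_apply, mul_one] at heq
  simp only [ContinuousMap.sub_apply]
  rw [integral_sub (integrable m z) (integrable m z'), heq, sub_self]

theorem hasVariance_sub (hA : IsIrreducible A) (hu : ∀ x, 0 < u x)
    (hfu : transferOp f u = u) (hm : IsEquilibriumState f m)
    (hz : transferOp f (z * u) = z' * u) :
    HasVariance (z - z') m (∫ x, z x ^ 2 ∂m - ∫ x, z' x ^ 2 ∂m) := by
  have := hm.isProbabilityMeasure hA hu hfu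
  have htendsto := tendsto_integral_birkhoffSum_sq continuous_shift
    (hm.measurePreserving_shift hA hu hfu) (hm.integral_mul_comp_shift hA hu hfu hz)
  simpa only [HasVariance, hm.integral_sub_eq_zero hA hu hfu hz, mul_zero, sub_zero,
    one_div_mul_eq_div] using htendsto

theorem letterMass_eq (hA : IsIrreducible A) (hq : ∀ i, 0 < q i)
    (hqW : q ᵥ* weightMatrix A F = q) (hr : ∀ i, 0 < r i) (hWr : weightMatrix A F *ᵥ r = r)
    (hm : IsEquilibriumState (letterFun A F) m) : letterMass m = (q ⬝ᵥ r)⁻¹ • (q * r) := by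
  have hfu : transferOp (letterFun A F) (letterFun A q) = letterFun A q := by
    rw [transferOp_letterFun, hqW]
  have hu (x : Subshift A) : 0 < letterFun A q x := hq _
  have := hm.isProbabilityMeasure hA hu hfu
  obtain ⟨μ, hμ, rfl⟩ := (isEquilibriumState_iff hA hu hfu).1 hm
  have := hμ.isProbabilityMeasure
  refine dotProduct_eq _ _ fun g => ?_
  have hmul (x : Subshift A) : letterFun A g x * letterFun A q x = letterFun A (g * q) x := rfl
  rw [dotProduct_comm, ← integral_letterFun, integral_tilted_log hu]
  simp_rw [hmul]
  rw [integral_letterFun, integral_letterFun, hμ.letterMass_eq hA hr hWr]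
  have hmass : (∑ i, r i)⁻¹ ≠ 0 :=
    inv_ne_zero (Finset.sum_pos (fun i _ => hr i) ⟨(Classical.arbitrary (Subshift A)).1 0,
      Finset.mem_univ _⟩).ne'
  have hcomm : (g * q) ⬝ᵥ r = (q * r) ⬝ᵥ g :=
    Finset.sum_congr rfl fun i _ => by simp only [Pi.mul_apply]; ring
  rw [dotProduct_smul, dotProduct_smul, smul_eq_mul, smul_eq_mul, mul_div_mul_left _ _ hmass,
    smul_dotProduct, hcomm, smul_eq_mul, div_eq_inv_mul]

theorem hasVariance_letterFun_sub (hA : IsIrreducible A) (hq : ∀ i, 0 < q i)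
    (hqW : q ᵥ* weightMatrix A F = q) (hm : IsEquilibriumState (letterFun A F) m) {ζ ζ' : ι → ℝ}
    (hζ : (ζ * q) ᵥ* weightMatrix A F = ζ' * q) :
    HasVariance (letterFun A (ζ - ζ')) m ((ζ ^ 2 - ζ' ^ 2) ⬝ᵥ letterMass m) := by
  have hfu : transferOp (letterFun A F) (letterFun A q) = letterFun A q := by
    rw [transferOp_letterFun, hqW]
  have hu (x : Subshift A) : 0 < letterFun A q x := hq _
  have hz : transferOp (letterFun A F) (letterFun A ζ * letterFun A q) =
      letterFun A ζ' * letterFun A q := by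
    rw [← letterFun_mul, transferOp_letterFun, hζ, letterFun_mul]
  have := hm.isProbabilityMeasure hA hu hfu
  rw [sub_dotProduct, ← integral_letterFun, ← integral_letterFun, letterFun_sub]
  exact hm.hasVariance_sub hA hu hfu hz

end IsEquilibriumState

end EquilibriumState

section Paths

open Subshift Matrix

variable {ι : Type*} {A : Matrix ι ι ℕ} {l v : ι → ℝ} {b d d' : ι} {T : ℝ}

/-- The admissible words that start with `d`, whose last letter may be followed by `b`, and whose
total `l`-length is less than `T`. -/
def pathsTo (A : Matrix ι ι ℕ) (l : ι → ℝ) (b d : ι) (T : ℝ) : Set (Σ n : ℕ, Fin (n + 1) → ι) :=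
  {γ | γ.2 0 = d ∧ (∀ i : Fin γ.1, A (γ.2 i.castSucc) (γ.2 i.succ) = 1) ∧
    A (γ.2 (Fin.last _)) b = 1 ∧ ∑ i, l (γ.2 i) < T}

/-- The word `γ` with the letter `d` in front. -/
def consPath (d : ι) (γ : Σ n : ℕ, Fin (n + 1) → ι) : Σ n : ℕ, Fin (n + 1) → ι :=
  ⟨γ.1 + 1, Fin.cons d γ.2⟩

theorem consPath_injective (d : ι) : Function.Injective (consPath d) := by
  rintro ⟨n, γ⟩ ⟨m, δ⟩ h
  obtain ⟨hnm, h⟩ := Sigma.mk.inj_iff.1 h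
  obtain rfl : n = m := Nat.succ_injective hnm
  obtain rfl : γ = δ := Fin.cons_right_injective (α := fun _ => ι) d (eq_of_heq h)
  rfl

theorem consPath_mem_pathsTo_iff {γ : Σ n : ℕ, Fin (n + 1) → ι} :
    consPath d γ ∈ pathsTo A l b d T ↔ A d (γ.2 0) = 1 ∧ γ ∈ pathsTo A l b (γ.2 0) (T - l d) := by
  simp only [pathsTo, consPath, Set.mem_ofPred_eq, Fin.forall_fin_succ, Fin.sum_univ_succ,
    ← Fin.succ_last, lt_sub_iff_add_lt']
  simp [and_assoc]

theorem pathsTo_eq_union [Fintype ι] (A : Matrix ι ι ℕ) (l : ι → ℝ) (b d : ι) (T : ℝ) :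
    pathsTo A l b d T = pathsTo A l b d T ∩ {⟨0, fun _ => d⟩} ∪
      ⋃ d' ∈ Finset.univ.filter (A d · = 1), consPath d '' pathsTo A l b d' (T - l d) := by
  refine subset_antisymm (fun γ hγ => ?_) (Set.union_subset Set.inter_subset_left ?_)
  · obtain ⟨_ | n, γ⟩ := γ
    · obtain rfl : γ = fun _ => d := funext fun i => (Fin.fin_one_eq_zero i) ▸ hγ.1
      exact .inl ⟨hγ, rfl⟩
    · have hcons : (⟨n + 1, γ⟩ : Σ n : ℕ, Fin (n + 1) → ι) = consPath d ⟨n, Fin.tail γ⟩ := by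
        simp [consPath, ← show γ 0 = d from hγ.1]
      rw [hcons, consPath_mem_pathsTo_iff] at hγ
      rw [hcons]
      exact .inr (Set.mem_biUnion (by simpa using hγ.1) ⟨_, hγ.2, rfl⟩)
  · refine Set.iUnion₂_subset fun d' hd' => ?_
    rintro _ ⟨γ, hγ, rfl⟩
    obtain rfl : γ.2 0 = d' := hγ.1
    exact consPath_mem_pathsTo_iff.2 ⟨by simpa using hd', hγ⟩

theorem pathsTo_eq_empty (hl : ∀ d, 0 < l d) (hT : T ≤ 0) : pathsTo A l b d T = ∅ :=
  Set.eq_empty_of_forall_notMem fun γ hγ =>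
    (hγ.2.2.2.trans_le hT).not_ge (Finset.sum_nonneg fun i _ => (hl (γ.2 i)).le)

theorem pathsTo_mono {T' : ℝ} (h : T ≤ T') : pathsTo A l b d T ⊆ pathsTo A l b d T' :=
  fun _ hγ => ⟨hγ.1, hγ.2.1, hγ.2.2.1, hγ.2.2.2.trans_le h⟩

theorem exists_pathsTo_nonempty (hA : IsIrreducible A) (l : ι → ℝ) (b d : ι) :
    ∃ T, (pathsTo A l b d T).Nonempty := by
  induction hA d b using Relation.TransGen.head_induction_on with
  | @single d h => exact ⟨l d + 1, ⟨0, fun _ => d⟩, rfl, fun i => i.elim0, h, by simp⟩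
  | @head d d' h _ ih =>
    obtain ⟨T, γ, hγ⟩ := ih
    obtain rfl : γ.2 0 = d' := hγ.1
    exact ⟨T + l d, consPath d γ, consPath_mem_pathsTo_iff.2 ⟨h, by rwa [add_sub_cancel_right]⟩⟩

theorem forall_of_forall_le_sub {P : ℝ → Prop} {a δ : ℝ} (hδ : 0 < δ) (hbase : ∀ T ≤ a, P T)
    (hstep : ∀ T, a < T → (∀ T' ≤ T - δ, P T') → P T) (T : ℝ) : P T := by
  have hind (n : ℕ) : ∀ T ≤ a + n * δ, P T := by
    induction n with
    | zero => simpa using hbase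
    | succ n ih =>
      intro T hT
      rcases le_or_gt T a with hTa | hTa
      · exact hbase T hTa
      · refine hstep T hTa fun T' hT' => ih T' ?_
        push_cast at hT
        linarith
  obtain ⟨n, hn⟩ := exists_nat_ge ((T - a) / δ)
  exact hind n T (by rw [div_le_iff₀ hδ] at hn; linarith)

theorem finite_pathsTo [Finite ι] (hl : ∀ d, 0 < l d) (b d : ι) (T : ℝ) :
    (pathsTo A l b d T).Finite := by
  have := Fintype.ofFinite ι
  have : Nonempty ι := ⟨d⟩
  obtain ⟨dmin, hdmin⟩ := Finite.exists_min l
  refine forall_of_forall_le_sub (P := fun T => ∀ d, (pathsTo A l b d T).Finite)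
    (a := 0) (hl dmin)
    (fun T hT d => by simp [pathsTo_eq_empty hl hT]) (fun T _ ih d => ?_) T d
  rw [pathsTo_eq_union]
  refine ((Set.finite_singleton _).inter_of_right _).union ?_
  exact (Finset.finite_toSet _).biUnion fun d' _ => (ih _ (sub_le_sub_left (hdmin d) T) d').image _

variable [Fintype ι]

theorem ncard_pathsTo_le_sum_add_one (hl : ∀ d, 0 < l d) (b d : ι) (T : ℝ) :
    (pathsTo A l b d T).ncard ≤ 1 + ∑ d' with A d d' = 1, (pathsTo A l b d' (T - l d)).ncard := by
  rw [pathsTo_eq_union]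
  refine (Set.ncard_union_le _ _).trans (add_le_add ?_ ?_)
  · exact (Set.ncard_le_ncard Set.inter_subset_right).trans (Set.ncard_singleton _).le
  · refine (Finset.set_ncard_biUnion_le _ _).trans (Finset.sum_le_sum fun d' _ => ?_)
    exact Set.ncard_image_le (finite_pathsTo hl b d' _)

theorem sum_ncard_pathsTo_le (hl : ∀ d, 0 < l d) (b d : ι) (T : ℝ) :
    ∑ d' with A d d' = 1, (pathsTo A l b d' (T - l d)).ncard ≤ (pathsTo A l b d T).ncard := by
  let paths (d' : ι) := consPath d '' pathsTo A l b d' (T - l d)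
  have hdisj : (Finset.univ.filter (A d · = 1) : Set ι).PairwiseDisjoint paths := by
    intro d₁ _ d₂ _ hne
    refine (Set.disjoint_image_iff (consPath_injective d)).2 (Set.disjoint_left.2 ?_)
    exact fun γ h₁ h₂ => hne (h₁.1.symm.trans h₂.1)
  calc ∑ d' with A d d' = 1, (pathsTo A l b d' (T - l d)).ncard
      = ∑ d' with A d d' = 1, (paths d').ncard :=
        Finset.sum_congr rfl fun d' _ =>
          (Set.ncard_image_of_injective _ (consPath_injective d)).symm
    _ = (⋃ d' ∈ Finset.univ.filter (A d · = 1), paths d').ncard := by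
        rw [← finsum_mem_coe_finset]
        exact ((Finset.finite_toSet _).ncard_biUnion
          (fun d' _ => (finite_pathsTo hl b d' _).image _) hdisj).symm
    _ ≤ (pathsTo A l b d T).ncard := by
        refine Set.ncard_le_ncard ?_ (finite_pathsTo hl b d T)
        rw [pathsTo_eq_union A l b d T]
        exact Set.subset_union_right

theorem weightMatrix_mulVec_apply (F v : ι → ℝ) (i : ι) :
    (weightMatrix A F *ᵥ v) i = Real.exp (F i) * ∑ j with A i j = 1, v j := by
  simp [mulVec, dotProduct, weightMatrix_apply, Finset.sum_filter, Finset.mul_sum]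

theorem sum_eq_exp_mul_of_mulVec_eq (hv : weightMatrix A (-l) *ᵥ v = v) (d : ι) :
    ∑ d' with A d d' = 1, v d' = Real.exp (l d) * v d := by
  conv_rhs => rw [← hv, weightMatrix_mulVec_apply, Pi.neg_apply, Real.exp_neg,
    mul_inv_cancel_left₀ (Real.exp_ne_zero _)]

/-- The recursion for the number of words is solved from above by
`K * v d * (exp (T + L) - 1)`: the term `-1` compensates for the word of the single letter `d`. -/
theorem ncard_pathsTo_le (hl : ∀ d, 0 < l d) (hv : weightMatrix A (-l) *ᵥ v = v) {K L : ℝ}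
    (hL : ∀ d, l d ≤ L) (hK : ∀ d, 1 ≤ K * v d * (Real.exp (l d) - 1)) (b d : ι) (hT : -L ≤ T) :
    (pathsTo A l b d T).ncard ≤ K * v d * (Real.exp (T + L) - 1) := by
  have : Nonempty ι := ⟨d⟩
  obtain ⟨dmin, hdmin⟩ := Finite.exists_min l
  refine forall_of_forall_le_sub (a := 0) (P := fun T => -L ≤ T → ∀ d,
    ((pathsTo A l b d T).ncard : ℝ) ≤ K * v d * (Real.exp (T + L) - 1)) (hl dmin)
    (fun T hT hLT d => ?_) (fun T hT ih _ d => ?_) T hT d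
  · have hKv : 0 < K * v d :=
      pos_of_mul_pos_left (one_pos.trans_le (hK d)) (sub_nonneg.2 (Real.one_le_exp (hl d).le))
    rw [pathsTo_eq_empty hl hT, Set.ncard_empty, Nat.cast_zero]
    exact mul_nonneg hKv.le (sub_nonneg.2 (Real.one_le_exp (by linarith)))
  · have hexp : Real.exp (T + L) = Real.exp (l d) * Real.exp (T - l d + L) := by
      rw [← Real.exp_add]
      ring_nf
    calc ((pathsTo A l b d T).ncard : ℝ)
        ≤ 1 + ∑ d' with A d d' = 1, ((pathsTo A l b d' (T - l d)).ncard : ℝ) := by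
          exact_mod_cast ncard_pathsTo_le_sum_add_one hl b d T
      _ ≤ 1 + ∑ d' with A d d' = 1, K * v d' * (Real.exp (T - l d + L) - 1) := by
          gcongr with d' _
          exact ih _ (by linarith [hdmin d]) (by linarith [hL d]) d'
      _ = 1 + K * v d * (Real.exp (T + L) - Real.exp (l d)) := by
          rw [← Finset.sum_mul, ← Finset.mul_sum, sum_eq_exp_mul_of_mulVec_eq hv, hexp]
          ring
      _ ≤ K * v d * (Real.exp (T + L) - 1) := by linarith [hK d]

theorem le_ncard_pathsTo (hl : ∀ d, 0 < l d) (hv : weightMatrix A (-l) *ᵥ v = v) {c L τ : ℝ}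
    (hL : ∀ d, l d ≤ L) (hτ : ∀ d, (pathsTo A l b d τ).Nonempty) (hcv : ∀ d, 0 ≤ c * v d)
    (hc : ∀ d, c * v d * Real.exp (τ + L) ≤ 1) (d : ι) (hT : τ ≤ T) :
    c * v d * Real.exp T ≤ (pathsTo A l b d T).ncard := by
  have : Nonempty ι := ⟨d⟩
  obtain ⟨dmin, hdmin⟩ := Finite.exists_min l
  refine forall_of_forall_le_sub (a := τ + L) (P := fun T => τ ≤ T → ∀ d,
    c * v d * Real.exp T ≤ (pathsTo A l b d T).ncard) (hl dmin)
    (fun T hT hτT d => ?_) (fun T hT ih _ d => ?_) T hT d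
  · have hpos : 1 ≤ (pathsTo A l b d T).ncard :=
      (Set.ncard_pos (finite_pathsTo hl b d T)).2 ((hτ d).mono (pathsTo_mono hτT))
    calc c * v d * Real.exp T ≤ c * v d * Real.exp (τ + L) := by
          gcongr
          exact hcv d
      _ ≤ 1 := hc d
      _ ≤ (pathsTo A l b d T).ncard := by exact_mod_cast hpos
  · have hexp : Real.exp T = Real.exp (l d) * Real.exp (T - l d) := by
      rw [← Real.exp_add]
      ring_nf
    calc c * v d * Real.exp T = ∑ d' with A d d' = 1, c * v d' * Real.exp (T - l d) := by
          rw [← Finset.sum_mul, ← Finset.mul_sum, sum_eq_exp_mul_of_mulVec_eq hv, hexp]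
          ring
      _ ≤ ∑ d' with A d d' = 1, ((pathsTo A l b d' (T - l d)).ncard : ℝ) := by
          gcongr with d' _
          exact ih _ (by linarith [hdmin d]) (by linarith [hL d]) d'
      _ ≤ (pathsTo A l b d T).ncard := by exact_mod_cast sum_ncard_pathsTo_le hl b d T

theorem isTheta_ncard_pathsTo (hA : IsIrreducible A) (hl : ∀ d, 0 < l d) (hv₀ : ∀ d, 0 < v d)
    (hv : weightMatrix A (-l) *ᵥ v = v) (b d : ι) :
    (fun T => ((pathsTo A l b d T).ncard : ℝ)) =Θ[atTop] Real.exp := by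
  obtain ⟨L, hL⟩ := Finite.bddAbove_range l
  replace hL (d : ι) : l d ≤ L := hL ⟨d, rfl⟩
  constructor
  · have hw (d : ι) : 0 < v d * (Real.exp (l d) - 1) :=
      mul_pos (hv₀ d) (sub_pos.2 (Real.one_lt_exp_iff.2 (hl d)))
    obtain ⟨K, hK⟩ := Finite.bddAbove_range fun d => (v d * (Real.exp (l d) - 1))⁻¹
    replace hK (d : ι) : (v d * (Real.exp (l d) - 1))⁻¹ ≤ K := hK ⟨d, rfl⟩
    have hK₀ : 0 ≤ K := (inv_nonneg.2 (hw d).le).trans (hK d)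
    refine .of_bound (K * v d * Real.exp L) ?_
    filter_upwards [eventually_ge_atTop (-L)] with T hT
    rw [Real.norm_natCast, Real.norm_of_nonneg (Real.exp_nonneg T)]
    refine (ncard_pathsTo_le hl hv hL (K := K) (fun d => ?_) b d hT).trans ?_
    · rw [mul_assoc]
      exact (inv_le_iff_one_le_mul₀ (hw d)).1 (hK d)
    · rw [mul_assoc (K * v d), ← Real.exp_add, add_comm L]
      exact mul_le_mul_of_nonneg_left (by linarith) (mul_nonneg hK₀ (hv₀ d).le)
  · choose τ' hτ' using exists_pathsTo_nonempty hA l b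
    obtain ⟨τ, hτ⟩ := Finite.bddAbove_range τ'
    obtain ⟨K, hK⟩ := Finite.bddAbove_range fun d => v d * Real.exp (τ + L)
    replace hK (d : ι) : v d * Real.exp (τ + L) ≤ K := hK ⟨d, rfl⟩
    have hK₀ : 0 < K := (mul_pos (hv₀ d) (Real.exp_pos _)).trans_le (hK d)
    refine .of_bound (K / v d) ?_
    filter_upwards [eventually_ge_atTop τ] with T hT
    rw [Real.norm_natCast, Real.norm_of_nonneg (Real.exp_nonneg T), div_mul_eq_mul_div,
      le_div_iff₀ (hv₀ d), mul_comm, ← inv_mul_le_iff₀ hK₀, ← mul_assoc]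
    refine le_ncard_pathsTo hl hv hL (fun d => (hτ' d).mono (pathsTo_mono (hτ ⟨d, rfl⟩)))
      (fun d => mul_nonneg (inv_nonneg.2 hK₀.le) (hv₀ d).le) (fun d => ?_) d hT
    rw [mul_assoc, inv_mul_le_one₀ hK₀]
    exact hK d

end Paths

theorem tendsto_log_div_of_isTheta_exp {f : ℝ → ℝ} (hf : f =Θ[atTop] Real.exp) :
    Tendsto (fun T => 1 / T * Real.log (f T)) atTop (𝓝 1) := by
  have hlim (C : ℝ) : Tendsto (fun T => 1 / T * (C + T)) atTop (𝓝 1) := by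
    have hinv := (tendsto_inv_atTop_zero.mul_const C).add_const 1
    rw [zero_mul, zero_add] at hinv
    refine hinv.congr' ?_
    filter_upwards [eventually_gt_atTop 0] with T hT
    field_simp
  have hlog {C : ℝ} (hC : 0 < C) (T : ℝ) :
      Real.log (C * ‖Real.exp T‖) = Real.log C + T := by
    rw [Real.norm_of_nonneg (Real.exp_nonneg T), Real.log_mul hC.ne' (Real.exp_ne_zero T),
      Real.log_exp]
  obtain ⟨C, hC, hfC⟩ := hf.2.exists_pos
  obtain ⟨C', hC', hfC'⟩ := hf.1.exists_pos
  refine tendsto_of_tendsto_of_tendsto_of_le_of_le' (hlim (Real.log C⁻¹)) (hlim (Real.log C')) ?_ ?_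
  all_goals
    filter_upwards [hfC.bound, hfC'.bound, eventually_gt_atTop 0] with T hlow hup hT
    have hpos : 0 < ‖f T‖ :=
      pos_of_mul_pos_right ((norm_pos_iff.2 (Real.exp_ne_zero T)).trans_le hlow) hC.le
    rw [← Real.log_abs (f T), ← Real.norm_eq_abs]
  · rw [← hlog (inv_pos.2 hC)]
    gcongr
    · exact mul_pos (inv_pos.2 hC) (norm_pos_iff.2 (Real.exp_ne_zero T))
    · exact (inv_mul_le_iff₀ hC).2 hlow
  · rw [← hlog hC']
    gcongr

namespace UGraph

open Subshift Matrix

variable {V E : Type*} {G : UGraph V E}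

theorem involutive_rev : Function.Involutive (rev : E × Bool → E × Bool) :=
  fun d => Prod.ext rfl (Bool.not_not d.2)

theorem start_rev (d : E × Bool) : G.start (rev d) = G.finish d := by
  rcases d with ⟨e, _ | _⟩ <;> rfl

theorem finish_rev (d : E × Bool) : G.finish (rev d) = G.start d := by
  rcases d with ⟨e, _ | _⟩ <;> rfl

/-- The row vector obtained from a column vector by reversing the direction of the edges; right
eigenvectors of the weighted adjacency matrix become left eigenvectors. -/
noncomputable def reversed (l : E → ℝ) (w : E × Bool → ℝ) (d : E × Bool) : ℝ :=
  Real.exp (l d.1) * w (rev d)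

theorem reversed_pos {r : E × Bool → ℝ} (hr₀ : ∀ d, 0 < r d) (l : E → ℝ) (d : E × Bool) :
    0 < reversed l r d :=
  mul_pos (Real.exp_pos _) (hr₀ _)

variable [DecidableEq V] [DecidableEq E]

theorem closedCycles_eq_iUnion_pathsTo (l : E → ℝ) (T : ℝ) :
    G.closedCycles l T = ⋃ d, pathsTo G.adj (fun d => l d.1) d d T := by
  ext ⟨n, γ⟩
  simp only [closedCycles, pathsTo, Set.mem_ofPred_eq, Set.mem_iUnion, Fin.forall_fin_succ',
    Fin.last_add_one, Fin.coeSucc_eq_succ]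
  constructor
  · rintro ⟨⟨hpath, hlast⟩, hlen⟩
    exact ⟨γ 0, rfl, hpath, hlast, hlen⟩
  · rintro ⟨d, rfl, hpath, hlast, hlen⟩
    exact ⟨⟨hpath, hlast⟩, hlen⟩

theorem isTheta_ncard_closedCycles [Fintype E] [Nonempty E] (hG : IsIrreducible G.adj) {l : E → ℝ}
    (hl : ∀ e, 0 < l e) {v : E × Bool → ℝ} (hv₀ : ∀ d, 0 < v d)
    (hv : weightMatrix G.adj (fun d => -l d.1) *ᵥ v = v) :
    (fun T => ((G.closedCycles l T).ncard : ℝ)) =Θ[atTop] Real.exp := by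
  have hpath (d : E × Bool) := isTheta_ncard_pathsTo hG (fun d => hl d.1) hv₀ hv d d
  obtain ⟨b⟩ : Nonempty (E × Bool) := inferInstance
  constructor
  · refine .trans (.of_norm_le fun T => ?_) (.sum fun d (_ : d ∈ Finset.univ) => (hpath d).1)
    rw [Real.norm_natCast, closedCycles_eq_iUnion_pathsTo, Finset.sum_apply]
    exact_mod_cast Set.ncard_iUnion_le_of_fintype _
  · refine (hpath b).2.trans (.of_norm_le fun T => ?_)
    rw [Real.norm_natCast, closedCycles_eq_iUnion_pathsTo, Nat.cast_le]
    exact Set.ncard_le_ncard (Set.subset_iUnion_of_subset b subset_rfl)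
      (Set.finite_iUnion fun d => finite_pathsTo (fun d => hl d.1) d d T)

theorem hasEntropy_one [Fintype E] [Nonempty E] (hG : IsIrreducible G.adj) {l : E → ℝ}
    (hl : ∀ e, 0 < l e) {v : E × Bool → ℝ} (hv₀ : ∀ d, 0 < v d)
    (hv : weightMatrix G.adj (fun d => -l d.1) *ᵥ v = v) : G.HasEntropy l 1 :=
  tendsto_log_div_of_isTheta_exp (isTheta_ncard_closedCycles hG hl hv₀ hv)

theorem HasEntropy.of_smul {l : E → ℝ} {s h : ℝ} (hs : 0 < s) (hl : G.HasEntropy (s • l) h) :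
    G.HasEntropy l (s * h) := by
  have hcycles (T : ℝ) : G.closedCycles (s • l) (s * T) = G.closedCycles l T := by
    simp only [closedCycles, Pi.smul_apply, smul_eq_mul, ← Finset.mul_sum,
      mul_lt_mul_iff_right₀ hs]
  refine ((hl.comp (tendsto_id.const_mul_atTop hs)).const_mul s).congr fun T => ?_
  simp only [Function.comp_apply, id_eq, hcycles]
  field_simp

theorem adj_rev_rev (d d' : E × Bool) : G.adj (rev d) (rev d') = G.adj d' d := by
  simp only [adj, start_rev, finish_rev, involutive_rev d, eq_comm (a := G.start d),
    ne_comm (a := rev d')]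

theorem neg_edgeFun [TopologicalSpace E] [DiscreteTopology E] (l : E → ℝ) :
    -G.edgeFun l = letterFun G.adj fun d => -l d.1 := rfl

variable [Fintype E] {l : E → ℝ} {r : E × Bool → ℝ}

theorem reversed_vecMul_weightMatrix (l : E → ℝ) (w : E × Bool → ℝ) :
    reversed l w ᵥ* weightMatrix G.adj (fun d => -l d.1) =
      reversed l (weightMatrix G.adj (fun d => -l d.1) *ᵥ w) := by
  funext d
  calc ∑ d', Real.exp (l d'.1) * w (rev d') * weightMatrix G.adj (fun d => -l d.1) d' d
    _ = ∑ d' with G.adj d' d = 1, w (rev d') := by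
        rw [Finset.sum_filter]
        refine Finset.sum_congr rfl fun d' _ => ?_
        rw [weightMatrix_apply, mul_ite_zero, mul_right_comm, ← Real.exp_add, add_neg_cancel,
          Real.exp_zero, one_mul]
    _ = ∑ d' with G.adj (rev d) d' = 1, w d' :=
        Finset.sum_equiv involutive_rev.toPerm (by simp [adj_rev_rev]) fun _ _ => rfl
    _ = Real.exp (l d.1) * (weightMatrix G.adj (fun d => -l d.1) *ᵥ w) (rev d) := by
        rw [weightMatrix_mulVec_apply, ← mul_assoc, ← Real.exp_add]
        simp [rev]

theorem reversed_vecMul_weightMatrix_of_mulVec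
    (hr : weightMatrix G.adj (fun d => -l d.1) *ᵥ r = r) :
    reversed l r ᵥ* weightMatrix G.adj (fun d => -l d.1) = reversed l r := by
  rw [reversed_vecMul_weightMatrix, hr]

variable [TopologicalSpace E] [DiscreteTopology E] [MeasurableSpace E] [DiscreteMeasurableSpace E]
  [Nonempty (Subshift G.adj)] {m : Measure (Subshift G.adj)}

theorem existsUnique_isEquilibriumState (hG : IsIrreducible G.adj) (hr₀ : ∀ d, 0 < r d)
    (hr : weightMatrix G.adj (fun d => -l d.1) *ᵥ r = r) :
    ∃! m, IsEquilibriumState (-G.edgeFun l) m := by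
  rw [neg_edgeFun]
  exact _root_.existsUnique_isEquilibriumState hG (reversed_pos hr₀ l)
    (reversed_vecMul_weightMatrix_of_mulVec hr) hr₀ hr

theorem letterMass_eq (hG : IsIrreducible G.adj) (hr₀ : ∀ d, 0 < r d)
    (hr : weightMatrix G.adj (fun d => -l d.1) *ᵥ r = r)
    (hm : IsEquilibriumState (-G.edgeFun l) m) :
    letterMass m = (reversed l r ⬝ᵥ r)⁻¹ • (reversed l r * r) := by
  rw [neg_edgeFun] at hm
  exact hm.letterMass_eq hG (reversed_pos hr₀ l) (reversed_vecMul_weightMatrix_of_mulVec hr) hr₀ hr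

theorem letterMass_rev (hG : IsIrreducible G.adj) (hr₀ : ∀ d, 0 < r d)
    (hr : weightMatrix G.adj (fun d => -l d.1) *ᵥ r = r)
    (hm : IsEquilibriumState (-G.edgeFun l) m) (d : E × Bool) :
    letterMass m (rev d) = letterMass m d := by
  simp only [letterMass_eq hG hr₀ hr hm, Pi.smul_apply, Pi.mul_apply, reversed, involutive_rev d,
    mul_right_comm _ (r d)]
  rfl

theorem integral_edgeFun_eq_zero (hG : IsIrreducible G.adj) (hr₀ : ∀ d, 0 < r d)
    (hr : weightMatrix G.adj (fun d => -l d.1) *ᵥ r = r)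
    (hm : IsEquilibriumState (-G.edgeFun l) m) {φ : E → ℝ} {η : E × Bool → ℝ}
    (hη : weightMatrix G.adj (fun d => -l d.1) *ᵥ (η * r) = (η - fun d => φ d.1) * r) :
    ∫ x, G.edgeFun φ x ∂m = 0 := by
  have hmass := letterMass_eq hG hr₀ hr hm
  have hleft := reversed_vecMul_weightMatrix_of_mulVec hr
  rw [neg_edgeFun] at hm
  have := hm.isProbabilityMeasure hG (u := letterFun G.adj (reversed l r))
    (fun x => reversed_pos hr₀ l (x.1 0)) (by rw [transferOp_letterFun, hleft])
  have hzero : (fun d => φ d.1) ⬝ᵥ (reversed l r * r) = 0 :=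
    calc (fun d => φ d.1) ⬝ᵥ (reversed l r * r)
      _ = reversed l r ⬝ᵥ (η * r - (η - fun d => φ d.1) * r) :=
        Finset.sum_congr rfl fun d _ => by simp only [Pi.mul_apply, Pi.sub_apply]; ring
      _ = 0 := by rw [← hη, dotProduct_sub, dotProduct_mulVec, hleft, sub_self]
  change ∫ x, letterFun G.adj (fun d => φ d.1) x ∂m = 0
  rw [integral_letterFun, hmass, dotProduct_smul, hzero, smul_zero]

theorem hasVariance_edgeFun (hG : IsIrreducible G.adj) (hr₀ : ∀ d, 0 < r d)
    (hr : weightMatrix G.adj (fun d => -l d.1) *ᵥ r = r)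
    (hm : IsEquilibriumState (-G.edgeFun l) m) {φ : E → ℝ} {η : E × Bool → ℝ}
    (hη : weightMatrix G.adj (fun d => -l d.1) *ᵥ (η * r) = (η - fun d => φ d.1) * r) :
    HasVariance (G.edgeFun φ) m (∑ d, φ d.1 * (2 * η d - φ d.1) * letterMass m d) := by
  have hmul (w : E × Bool → ℝ) : (w ∘ rev) * reversed l r = reversed l (w * r) := by
    funext d
    simp only [Pi.mul_apply, reversed, Function.comp_apply]
    ring
  have hζ : ((η ∘ rev) * reversed l r) ᵥ* weightMatrix G.adj (fun d => -l d.1) =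
      ((η - fun d => φ d.1) ∘ rev) * reversed l r := by
    rw [hmul, hmul, reversed_vecMul_weightMatrix, hη]
  have hφ : G.edgeFun φ = letterFun G.adj (η ∘ rev - (η - fun d => φ d.1) ∘ rev) := by
    ext x
    simp [rev, edgeFun]
  have hrev := letterMass_rev hG hr₀ hr hm
  rw [neg_edgeFun] at hm
  rw [hφ]
  convert hm.hasVariance_letterFun_sub hG (reversed_pos hr₀ l)
    (reversed_vecMul_weightMatrix_of_mulVec hr) hζ using 1
  rw [← Equiv.sum_comp involutive_rev.toPerm, dotProduct]
  refine Finset.sum_congr rfl fun d _ => ?_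
  simp only [Function.Involutive.coe_toPerm, hrev, Pi.sub_apply, Pi.pow_apply,
    Function.comp_apply, show (rev d).1 = d.1 from rfl]
  ring

end UGraph

section Dumbbell

open Subshift Matrix UGraph

theorem exp_sub_one_pos {x : ℝ} (hx : 0 < x) : 0 < Real.exp x - 1 :=
  sub_pos.2 (Real.one_lt_exp_iff.2 hx)

theorem isIrreducible_dumbbell_adj : IsIrreducible dumbbell.adj :=
  isIrreducible_of_cycle (c := ![(0, true), (2, true), (1, true), (2, false), (0, false), (2, true),
    (1, false), (2, false)]) (by decide) (by decide)

instance : Nonempty (Subshift dumbbell.adj) :=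
  ⟨⟨fun _ => (0, true), fun _ => show dumbbell.adj (0, true) (0, true) = 1 by decide⟩⟩

theorem sum_dumbbell_edges (g : Fin 3 × Bool → ℝ) :
    ∑ d, g d = g (0, true) + g (0, false) + (g (1, true) + g (1, false)) +
      (g (2, true) + g (2, false)) := by
  simp only [Fintype.sum_prod_type, Fin.sum_univ_three, Fintype.sum_bool]

theorem sum_dumbbell_successors (g : Fin 3 × Bool → ℝ) (d : Fin 3 × Bool) :
    ∑ d' with dumbbell.adj d d' = 1, g d' =
      ![g (0, d.2) + g (2, true), g (1, d.2) + g (2, false),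
        if d.2 then g (1, true) + g (1, false) else g (0, true) + g (0, false)] d.1 := by
  rw [Finset.sum_filter, sum_dumbbell_edges]
  obtain ⟨e, c⟩ := d
  fin_cases e <;> cases c <;> simp [adj, start, finish, rev, dumbbell]

/-- The Perron eigenvector of the weighted adjacency matrix of the dumbbell, for the lengths `l` of
the edges on the surface of entropy `1`. -/
noncomputable def dumbbellPerron (l : Fin 3 → ℝ) (d : Fin 3 × Bool) : ℝ :=
  ![1, Real.exp (l 2) * (Real.exp (l 0) - 1) / 2,
    if d.2 then Real.exp (l 0) - 1 else 2 / Real.exp (l 2)] d.1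

variable {l : Fin 3 → ℝ}

theorem dumbbellPerron_pos (hl : 0 < l 0) (d : Fin 3 × Bool) :
    0 < dumbbellPerron l d := by
  have hX := exp_sub_one_pos hl
  obtain ⟨e, b⟩ := d
  have hbridge : 0 < if b then Real.exp (l 0) - 1 else 2 / Real.exp (l 2) := by
    split_ifs <;> positivity
  fin_cases e
  exacts [one_pos, half_pos (mul_pos (Real.exp_pos _) hX), hbridge]

theorem mulVec_dumbbellPerron
    (h : Real.exp (l 2) ^ 2 * ((Real.exp (l 0) - 1) * (Real.exp (l 1) - 1)) = 4) :
    weightMatrix dumbbell.adj (fun d => -l d.1) *ᵥ dumbbellPerron l = dumbbellPerron l := by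
  funext ⟨e, c⟩
  rw [weightMatrix_mulVec_apply, Real.exp_neg, inv_mul_eq_iff_eq_mul₀ (Real.exp_ne_zero _),
    sum_dumbbell_successors]
  simp only [dumbbellPerron, cons_val]
  fin_cases e
  · simp only [Fin.zero_eta, cons_val, reduceIte]
    ring
  · simp only [Fin.mk_one, cons_val, Bool.false_eq_true, reduceIte]
    field_simp
    linear_combination -h
  · simp only [Fin.reduceFinMk, cons_val, reduceIte]
    cases c <;> simp only [Bool.false_eq_true, reduceIte] <;> field_simp <;> ring

theorem eq_dumbbellS_iff {x y z : ℝ} (hx : 0 < x) (hy : 0 < y) :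
    z = dumbbellS x y ↔ Real.exp z ^ 2 * ((Real.exp x - 1) * (Real.exp y - 1)) = 4 := by
  have hX := exp_sub_one_pos hx
  have hY := exp_sub_one_pos hy
  have hlog4 : Real.log 4 = 2 * Real.log 2 := by
    rw [show (4 : ℝ) = 2 ^ 2 by norm_num, Real.log_pow, Nat.cast_ofNat]
  rw [← Real.log_injOn_pos.eq_iff (Set.mem_Ioi.2 (by positivity)) (Set.mem_Ioi.2 four_pos),
    Real.log_mul (by positivity) (by positivity), Real.log_pow, Real.log_exp, Nat.cast_ofNat, hlog4,
    dumbbellS]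
  constructor <;> intro h <;> linarith

theorem dumbbellS_pos_iff {x y : ℝ} (hx : 0 < x) (hy : 0 < y) :
    0 < dumbbellS x y ↔ (Real.exp x - 1) * (Real.exp y - 1) < 4 := by
  have hX := exp_sub_one_pos hx
  have hY := exp_sub_one_pos hy
  rw [← (eq_dumbbellS_iff hx hy).1 rfl, lt_mul_iff_one_lt_left (mul_pos hX hY),
    one_lt_sq_iff₀ (Real.exp_nonneg _), Real.one_lt_exp_iff]

theorem mem_image_dumbbellLength_iff :
    l ∈ (fun q : ℝ × ℝ => dumbbellLength q.1 q.2) '' dumbbellDomain ↔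
      (∀ e, 0 < l e) ∧
        Real.exp (l 2) ^ 2 * ((Real.exp (l 0) - 1) * (Real.exp (l 1) - 1)) = 4 := by
  constructor
  · rintro ⟨⟨x, y⟩, ⟨hx, hy, hxy⟩, rfl⟩
    refine ⟨?_, (eq_dumbbellS_iff hx hy).1 rfl⟩
    simp only [Fin.forall_fin_succ]
    exact ⟨hx, hy, (dumbbellS_pos_iff hx hy).2 hxy, nofun⟩
  · rintro ⟨hl, h⟩
    have hS := (eq_dumbbellS_iff (hl 0) (hl 1)).2 h
    refine ⟨(l 0, l 1), ⟨hl 0, hl 1, (dumbbellS_pos_iff (hl 0) (hl 1)).1 (hS ▸ hl 2)⟩, ?_⟩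
    funext e
    fin_cases e
    exacts [rfl, rfl, hS.symm]

theorem exists_smul_mem_image_dumbbellLength (hl : ∀ e, 0 < l e) :
    ∃ s : ℝ, 0 < s ∧ s • l ∈ (fun q : ℝ × ℝ => dumbbellLength q.1 q.2) '' dumbbellDomain := by
  let g (s : ℝ) : ℝ :=
    Real.exp (s * l 2) ^ 2 * ((Real.exp (s * l 0) - 1) * (Real.exp (s * l 1) - 1))
  have hg₀ : g 0 = 0 := by simp [g]
  have hexp (e : Fin 3) : Tendsto (fun s => Real.exp (s * l e)) atTop atTop :=
    Real.tendsto_exp_atTop.comp (tendsto_id.atTop_mul_const (hl e))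
  have hexp' (e : Fin 3) : Tendsto (fun s => Real.exp (s * l e) - 1) atTop atTop :=
    tendsto_atTop_add_const_right _ (-1) (hexp e)
  have hg : Tendsto g atTop atTop :=
    ((tendsto_pow_atTop two_ne_zero).comp (hexp 2)).atTop_mul_atTop₀
      ((hexp' 0).atTop_mul_atTop₀ (hexp' 1))
  obtain ⟨s, hs, hgs⟩ := isPreconnected_Ici.intermediate_value_Ici (Set.self_mem_Ici (a := (0 : ℝ)))
    (le_principal_iff.2 (Ici_mem_atTop 0)) (by fun_prop : Continuous g).continuousOn hg
    (show 4 ∈ Set.Ici (g 0) by simp [hg₀])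
  have hs₀ : s ≠ 0 := by
    rintro rfl
    simp [hg₀] at hgs
  have hs_pos : 0 < s := lt_of_le_of_ne hs hs₀.symm
  exact ⟨s, hs_pos, mem_image_dumbbellLength_iff.2 ⟨fun e => mul_pos hs_pos (hl e), hgs⟩⟩

theorem dumbbell_moduliSpace_eq :
    dumbbell.moduliSpace = (fun q : ℝ × ℝ => dumbbellLength q.1 q.2) '' dumbbellDomain := by
  have hasEntropy {l : Fin 3 → ℝ}
      (h : l ∈ (fun q : ℝ × ℝ => dumbbellLength q.1 q.2) '' dumbbellDomain) :
      dumbbell.HasEntropy l 1 := by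
    obtain ⟨hl, h⟩ := mem_image_dumbbellLength_iff.1 h
    exact hasEntropy_one isIrreducible_dumbbell_adj hl (dumbbellPerron_pos (hl 0))
      (mulVec_dumbbellPerron h)
  refine Set.Subset.antisymm (fun l ⟨hl, hent⟩ => ?_)
    fun l h => ⟨(mem_image_dumbbellLength_iff.1 h).1, hasEntropy h⟩
  obtain ⟨s, hs, h⟩ := exists_smul_mem_image_dumbbellLength hl
  obtain rfl : s = 1 := by
    simpa using tendsto_nhds_unique ((hasEntropy h).of_smul hs) hent
  rwa [one_smul] at h

theorem hasDerivAt_dumbbellS_left {x : ℝ} (y : ℝ) (hx : 0 < x) (hy : 0 < y) :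
    HasDerivAt (fun s => dumbbellS s y) (-(1 / 2) * (Real.exp x / (Real.exp x - 1))) x := by
  have hX := exp_sub_one_pos hx
  have hY := exp_sub_one_pos hy
  have hlog := (((Real.hasDerivAt_exp x).sub_const 1).mul_const (Real.exp y - 1)).log
    (mul_pos hX hY).ne'
  refine ((hlog.const_mul (1 / 2)).const_sub (Real.log 2)).congr_deriv ?_
  field_simp

theorem dumbbellS_comm (x y : ℝ) : dumbbellS x y = dumbbellS y x := by
  rw [dumbbellS, dumbbellS, mul_comm (Real.exp x - 1)]

theorem hasDerivAt_dumbbellS_right (x : ℝ) {y : ℝ} (hx : 0 < x) (hy : 0 < y) :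
    HasDerivAt (fun s => dumbbellS x s) (-(1 / 2) * (Real.exp y / (Real.exp y - 1))) y := by
  simp_rw [dumbbellS_comm x]
  exact hasDerivAt_dumbbellS_left x hy hx

theorem iteratedDeriv_two_dumbbellS_left {x y : ℝ} (hx : 0 < x) (hy : 0 < y) :
    iteratedDeriv 2 (fun s => dumbbellS s y) x =
      1 / 2 * (Real.exp x / (Real.exp x - 1) ^ 2) := by
  have hX := exp_sub_one_pos hx
  rw [iteratedDeriv_succ, iteratedDeriv_one]
  have hderiv : deriv (fun s => dumbbellS s y) =ᶠ[𝓝 x]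
      fun s => -(1 / 2) * (Real.exp s / (Real.exp s - 1)) := by
    filter_upwards [lt_mem_nhds hx] with s hs
    exact (hasDerivAt_dumbbellS_left y hs hy).deriv
  rw [hderiv.deriv_eq]
  have hdiv := (Real.hasDerivAt_exp x).div ((Real.hasDerivAt_exp x).sub_const 1) hX.ne'
  refine (hdiv.const_mul (-(1 / 2))).deriv.trans ?_
  field_simp
  ring

theorem iteratedDeriv_two_dumbbellS_right {x y : ℝ} (hx : 0 < x) (hy : 0 < y) :
    iteratedDeriv 2 (fun s => dumbbellS x s) y =
      1 / 2 * (Real.exp y / (Real.exp y - 1) ^ 2) := by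
  simp_rw [dumbbellS_comm x]
  exact iteratedDeriv_two_dumbbellS_left hy hx

theorem hasDerivAt_dumbbellLength_left {x y : ℝ} (hx : 0 < x) (hy : 0 < y) :
    HasDerivAt (fun s => dumbbellLength s y)
      ![1, 0, -(1 / 2) * (Real.exp x / (Real.exp x - 1))] x := by
  rw [hasDerivAt_pi]
  intro e
  fin_cases e
  · exact hasDerivAt_id x
  · exact hasDerivAt_const x y
  · exact hasDerivAt_dumbbellS_left y hx hy

theorem hasDerivAt_dumbbellLength_right {x y : ℝ} (hx : 0 < x) (hy : 0 < y) :
    HasDerivAt (fun s => dumbbellLength x s)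
      ![0, 1, -(1 / 2) * (Real.exp y / (Real.exp y - 1))] y := by
  rw [hasDerivAt_pi]
  intro e
  fin_cases e
  · exact hasDerivAt_const y x
  · exact hasDerivAt_id y
  · exact hasDerivAt_dumbbellS_right x hx hy

/-- The mass that the equilibrium state gives to either direction of an edge, relative to that of
the joining edge. On the loops these are also the partial derivatives of `-S`. -/
noncomputable def dumbbellWeight (x y : ℝ) : Fin 3 → ℝ :=
  ![Real.exp x / (2 * (Real.exp x - 1)), Real.exp y / (2 * (Real.exp y - 1)), 1]

/-- The solution `η` of the Poisson equation on the dumbbell (see `mulVec_dumbbellCorrector`) for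
the tangent vector `s ∂l/∂x + t ∂l/∂y`, whose component on the joining edge is `-(α + β)`. -/
noncomputable def dumbbellCorrector (x y s t : ℝ) (d : Fin 3 × Bool) : ℝ :=
  let α := s * dumbbellWeight x y 0
  let β := t * dumbbellWeight x y 1
  ![(3 * α + β) / 2, (α + 3 * β) / 2, if d.2 then (β - α) / 2 else (α - β) / 2] d.1

variable {x y : ℝ}

theorem smul_dumbbellDx_add_smul_dumbbellDy (hx : 0 < x) (hy : 0 < y) (s t : ℝ) :
    s • dumbbellDx x y + t • dumbbellDy x y =
      ![s, t, -(s * dumbbellWeight x y 0 + t * dumbbellWeight x y 1)] := by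
  rw [dumbbellDx, dumbbellDy, (hasDerivAt_dumbbellLength_left hx hy).deriv,
    (hasDerivAt_dumbbellLength_right hx hy).deriv]
  funext e
  fin_cases e
  · simp
  · simp
  · simp only [Pi.add_apply, Pi.smul_apply, smul_eq_mul, dumbbellWeight, Fin.reduceFinMk, cons_val]
    field_simp
    ring

theorem mulVec_dumbbellCorrector (hx : 0 < x) (hy : 0 < y) (s t : ℝ) :
    weightMatrix dumbbell.adj (fun d => -dumbbellLength x y d.1) *ᵥ
        (dumbbellCorrector x y s t * dumbbellPerron (dumbbellLength x y)) =
      (dumbbellCorrector x y s t - fun d => (s • dumbbellDx x y + t • dumbbellDy x y) d.1) *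
        dumbbellPerron (dumbbellLength x y) := by
  have hX := exp_sub_one_pos hx
  have hY := exp_sub_one_pos hy
  have hS := (eq_dumbbellS_iff hx hy).1 rfl
  rw [smul_dumbbellDx_add_smul_dumbbellDy hx hy]
  funext ⟨e, c⟩
  rw [weightMatrix_mulVec_apply, Real.exp_neg, inv_mul_eq_iff_eq_mul₀ (Real.exp_ne_zero _),
    sum_dumbbell_successors]
  simp only [dumbbellLength, dumbbellPerron, dumbbellCorrector, dumbbellWeight, Pi.mul_apply,
    Pi.sub_apply, cons_val]
  fin_cases e
  · simp only [Fin.zero_eta, cons_val, reduceIte]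
    field_simp
    ring
  · simp only [Fin.mk_one, cons_val, Bool.false_eq_true, reduceIte]
    field_simp
    linear_combination ((Real.exp x - 1) * t * Real.exp y - s * Real.exp x * (Real.exp y - 1)) * hS
  · simp only [Fin.reduceFinMk, cons_val, reduceIte]
    cases c <;> simp only [Bool.false_eq_true, reduceIte] <;> field_simp <;> ring

theorem reversed_mul_dumbbellPerron (hx : 0 < x) (hy : 0 < y) :
    reversed (dumbbellLength x y) (dumbbellPerron (dumbbellLength x y)) *
        dumbbellPerron (dumbbellLength x y) =
      (2 * (Real.exp x - 1)) • fun d => dumbbellWeight x y d.1 := by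
  have hX := exp_sub_one_pos hx
  have hY := exp_sub_one_pos hy
  have hS := (eq_dumbbellS_iff hx hy).1 rfl
  funext ⟨e, c⟩
  simp only [reversed, rev, dumbbellLength, dumbbellPerron, dumbbellWeight, Pi.mul_apply,
    Pi.smul_apply, smul_eq_mul, cons_val]
  fin_cases e
  · simp only [Fin.zero_eta, cons_val]
    field_simp
  · simp only [Fin.mk_one, cons_val]
    field_simp
    linear_combination hS
  · simp only [Fin.reduceFinMk, cons_val]
    cases c <;> simp only [Bool.not_true, Bool.not_false, Bool.false_eq_true, reduceIte] <;>
      field_simp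

theorem sum_dumbbellWeight (hx : 0 < x) (hy : 0 < y) :
    ∑ d : Fin 3 × Bool, dumbbellWeight x y d.1 =
      (4 * Real.exp (x + y) - 3 * Real.exp x - 3 * Real.exp y + 2) /
        ((Real.exp x - 1) * (Real.exp y - 1)) := by
  have hX := exp_sub_one_pos hx
  have hY := exp_sub_one_pos hy
  rw [sum_dumbbell_edges, Real.exp_add]
  simp only [dumbbellWeight, cons_val]
  field_simp
  ring

section EquilibriumState

variable {m : Measure (Subshift dumbbell.adj)}

theorem letterMass_dumbbell (hx : 0 < x) (hy : 0 < y)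
    (hm : IsEquilibriumState (-dumbbell.edgeFun (dumbbellLength x y)) m) :
    letterMass m = (∑ d : Fin 3 × Bool, dumbbellWeight x y d.1)⁻¹ •
      fun d => dumbbellWeight x y d.1 := by
  have hX : 2 * (Real.exp x - 1) ≠ 0 := (mul_pos two_pos (exp_sub_one_pos hx)).ne'
  have hqr := reversed_mul_dumbbellPerron hx hy
  have hsum : reversed (dumbbellLength x y) (dumbbellPerron (dumbbellLength x y)) ⬝ᵥ
      dumbbellPerron (dumbbellLength x y) =
        2 * (Real.exp x - 1) * ∑ d : Fin 3 × Bool, dumbbellWeight x y d.1 := by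
    rw [Finset.mul_sum]
    exact Finset.sum_congr rfl fun d _ => congrFun hqr d
  rw [UGraph.letterMass_eq isIrreducible_dumbbell_adj (dumbbellPerron_pos hx)
    (mulVec_dumbbellPerron ((eq_dumbbellS_iff hx hy).1 rfl)) hm, hsum, hqr, smul_smul, mul_inv,
    mul_right_comm, inv_mul_cancel₀ hX, one_mul]

theorem measureReal_dumbbell_bridge (hx : 0 < x) (hy : 0 < y)
    (hm : IsEquilibriumState (-dumbbell.edgeFun (dumbbellLength x y)) m) :
    m.real {e | e.1 0 = (2, true)} = (Real.exp x - 1) * (Real.exp y - 1) /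
      (4 * Real.exp (x + y) - 3 * Real.exp x - 3 * Real.exp y + 2) := by
  change letterMass m (2, true) = _
  rw [letterMass_dumbbell hx hy hm, sum_dumbbellWeight hx hy]
  simp [dumbbellWeight]

theorem letterMass_dumbbell_apply (hx : 0 < x) (hy : 0 < y)
    (hm : IsEquilibriumState (-dumbbell.edgeFun (dumbbellLength x y)) m) (d : Fin 3 × Bool) :
    letterMass m d = dumbbellWeight x y d.1 * m.real {e | e.1 0 = (2, true)} := by
  change _ = _ * letterMass m (2, true)
  rw [letterMass_dumbbell hx hy hm]
  simp [dumbbellWeight, mul_comm]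

theorem existsUnique_isEquilibriumState_dumbbell (hx : 0 < x) (hy : 0 < y) :
    ∃! m, IsEquilibriumState (-dumbbell.edgeFun (dumbbellLength x y)) m :=
  UGraph.existsUnique_isEquilibriumState isIrreducible_dumbbell_adj (dumbbellPerron_pos hx)
    (mulVec_dumbbellPerron ((eq_dumbbellS_iff hx hy).1 rfl))

theorem smul_dumbbellDx_add_smul_dumbbellDy_mem_tangentSpace (hx : 0 < x) (hy : 0 < y)
    (hm : IsEquilibriumState (-dumbbell.edgeFun (dumbbellLength x y)) m) (s t : ℝ) :
    dumbbell.edgeFun (s • dumbbellDx x y + t • dumbbellDy x y) ∈ dumbbell.tangentSpace m :=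
  ⟨⟨fun d => (s • dumbbellDx x y + t • dumbbellDy x y) d.1, fun _ => rfl⟩,
    integral_edgeFun_eq_zero isIrreducible_dumbbell_adj (dumbbellPerron_pos hx)
      (mulVec_dumbbellPerron ((eq_dumbbellS_iff hx hy).1 rfl)) hm
      (mulVec_dumbbellCorrector hx hy s t)⟩

theorem hasVariance_smul_dumbbellDx_add_smul_dumbbellDy (hx : 0 < x) (hy : 0 < y)
    (hm : IsEquilibriumState (-dumbbell.edgeFun (dumbbellLength x y)) m) (s t : ℝ) :
    HasVariance (dumbbell.edgeFun (s • dumbbellDx x y + t • dumbbellDy x y)) m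
      (2 * iteratedDeriv 2 (fun s => dumbbellS s y) x * m.real {e | e.1 0 = (2, true)} * s ^ 2 +
        2 * iteratedDeriv 2 (fun s => dumbbellS x s) y * m.real {e | e.1 0 = (2, true)} *
          t ^ 2) := by
  have hX := exp_sub_one_pos hx
  have hY := exp_sub_one_pos hy
  convert hasVariance_edgeFun isIrreducible_dumbbell_adj (dumbbellPerron_pos hx)
    (mulVec_dumbbellPerron ((eq_dumbbellS_iff hx hy).1 rfl)) hm
    (mulVec_dumbbellCorrector hx hy s t) using 1
  simp only [letterMass_dumbbell_apply hx hy hm, smul_dumbbellDx_add_smul_dumbbellDy hx hy]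
  rw [iteratedDeriv_two_dumbbellS_left hx hy, iteratedDeriv_two_dumbbellS_right hx hy,
    sum_dumbbell_edges]
  simp only [dumbbellCorrector, dumbbellWeight, cons_val, Bool.false_eq_true, reduceIte]
  field_simp
  ring

theorem two_mul_iteratedDeriv_dumbbellS_left_mul_measureReal (hx : 0 < x) (hy : 0 < y)
    (hm : IsEquilibriumState (-dumbbell.edgeFun (dumbbellLength x y)) m) :
    2 * iteratedDeriv 2 (fun s => dumbbellS s y) x * m.real {e | e.1 0 = (2, true)} =
      Real.exp x * (Real.exp y - 1) / ((Real.exp x - 1) *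
        (4 * Real.exp (x + y) - 3 * Real.exp x - 3 * Real.exp y + 2)) := by
  have hX := exp_sub_one_pos hx
  rw [iteratedDeriv_two_dumbbellS_left hx hy, measureReal_dumbbell_bridge hx hy hm]
  field_simp

theorem two_mul_iteratedDeriv_dumbbellS_right_mul_measureReal (hx : 0 < x) (hy : 0 < y)
    (hm : IsEquilibriumState (-dumbbell.edgeFun (dumbbellLength x y)) m) :
    2 * iteratedDeriv 2 (fun s => dumbbellS x s) y * m.real {e | e.1 0 = (2, true)} =
      (Real.exp x - 1) * Real.exp y / ((Real.exp y - 1) *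
        (4 * Real.exp (x + y) - 3 * Real.exp x - 3 * Real.exp y + 2)) := by
  have hY := exp_sub_one_pos hy
  rw [iteratedDeriv_two_dumbbellS_right hx hy, measureReal_dumbbell_bridge hx hy hm]
  field_simp

end EquilibriumState

end Dumbbell

theorem proposition4p6 :
    dumbbell.moduliSpace = (fun q : ℝ × ℝ => dumbbellLength q.1 q.2) '' dumbbellDomain ∧
    ∀ x y : ℝ, (x, y) ∈ dumbbellDomain →
      DifferentiableAt ℝ (fun s => dumbbellLength s y) x ∧
      DifferentiableAt ℝ (fun s => dumbbellLength x s) y ∧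
      (∃! m : Measure (Subshift dumbbell.adj),
        IsEquilibriumState (-dumbbell.edgeFun (dumbbellLength x y)) m) ∧
      ∀ m : Measure (Subshift dumbbell.adj),
        IsEquilibriumState (-dumbbell.edgeFun (dumbbellLength x y)) m →
        dumbbell.edgeFun (dumbbellDx x y) ∈ dumbbell.tangentSpace m ∧
        dumbbell.edgeFun (dumbbellDy x y) ∈ dumbbell.tangentSpace m ∧
        ∃ EP FP GP VP : ℝ,
          HasVariance (dumbbell.edgeFun (dumbbellDx x y)) m EP ∧
          EP = 2 * iteratedDeriv 2 (fun s => dumbbellS s y) x * m.real {e | e.1 0 = (2, true)} ∧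
          EP = Real.exp x * (Real.exp y - 1) /
            ((Real.exp x - 1) *
              (4 * Real.exp (x + y) - 3 * Real.exp x - 3 * Real.exp y + 2)) ∧
          HasVariance (dumbbell.edgeFun (dumbbellDx x y + dumbbellDy x y)) m VP ∧
          FP = 1 / 2 * (VP - EP - GP) ∧
          FP = 0 ∧
          HasVariance (dumbbell.edgeFun (dumbbellDy x y)) m GP ∧
          GP = 2 * iteratedDeriv 2 (fun s => dumbbellS x s) y * m.real {e | e.1 0 = (2, true)} ∧
          GP = (Real.exp x - 1) * Real.exp y /
            ((Real.exp y - 1) *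
              (4 * Real.exp (x + y) - 3 * Real.exp x - 3 * Real.exp y + 2)) ∧
          ∀ a b : ℝ, HasVariance (dumbbell.edgeFun (a • dumbbellDx x y + b • dumbbellDy x y)) m
            (EP * a ^ 2 + 2 * FP * a * b + GP * b ^ 2) := by
  refine ⟨dumbbell_moduliSpace_eq, fun x y ⟨hx, hy, _⟩ =>
    ⟨(hasDerivAt_dumbbellLength_left hx hy).differentiableAt,
      (hasDerivAt_dumbbellLength_right hx hy).differentiableAt,
      existsUnique_isEquilibriumState_dumbbell hx hy, fun m hm => ?_⟩⟩
  have htangent := smul_dumbbellDx_add_smul_dumbbellDy_mem_tangentSpace hx hy hm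
  have hvar := hasVariance_smul_dumbbellDx_add_smul_dumbbellDy hx hy hm
  refine ⟨by simpa using htangent 1 0, by simpa using htangent 0 1, _, 0, _, _,
    by simpa using hvar 1 0, rfl, two_mul_iteratedDeriv_dumbbellS_left_mul_measureReal hx hy hm,
    by simpa using hvar 1 1, by ring, rfl,
    by simpa using hvar 0 1, rfl, two_mul_iteratedDeriv_dumbbellS_right_mul_measureReal hx hy hm,
    fun a b => ?_⟩
  convert hvar a b using 1
  ring
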